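/- **Setting.** Let $(V,\omega_0)$ be a real symplectic vector space of dimension $2n$, $J_0$ a compatible positive complex structure on it (so $J_0^2=-1$ and $g_0(u,v)=\omega_0(J_0u,v)$ is a scalar product), $L\subseteq V$ a Lagrangian subspace, $\lambda:\widetilde G\to Sp(V,\omega_0)$ the metaplectic group (the connected two-fold covering group), $\widetilde K=\lambda^{-1}(O(V,g_0)\cap Sp(V,\omega_0))$, and $\check\sigma$ a Segal–Shale–Weil representation of $\widetilde G$ on $\check H=L^2(L)$. Let $H$ be the continuous dual of $\check H$, with the dual representation $\sigma(g)u=u\circ\check\sigma(g)^{-1}$, let $f^\sharp\in\check H$ denote the Riesz representative of $f\in H$ and $v^\flat=(v,\cdot)\in H$ for $v\in\check H$, and for $v\in\check H$, $f\in H$ put $v\otimes f: w\mapsto f(w)v$. Let $CH$ be the algebra of compact operators on $\check H$, with the representation $\rho(g)a=\check\sigma(g)a\check\sigma(g)^{-1}$. On $H^\bullet=\bigoplus_{k=0}^{2n}\bigwedge^kV^*\otimes H$ consider the representation $\sigma^\bullet(g)(\alpha\otimes u)=(\lambda(g)^{-1})^*\alpha\otimes\sigma(g)u$, the right action $(\alpha\otimes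 u)\cdot a=\alpha\otimes(u\circ a)$ of $CH$, and the $CH$-valued product $(\alpha\otimes u,\beta\otimes v)=g_0(\alpha,\beta)\,u^\sharp\otimes v$, where $g_0$ also denotes the induced scalar product of forms (forms of different degrees being orthogonal). Let $(M,\omega)$ be a symplectic manifold of dimension $2n$ with a metaplectic structure, i.e. a principal $\widetilde G$-bundle $\mathcal P\to M$ and a map $\Lambda$ over $M$ from $\mathcal P$ to the bundle of symplectic frames $V\to T_mM$ that is equivariant with respect to $\lambda$. Let a compatible positive almost complex structure on $M$ be given, with Riemannian metric $g$, and let $\mathcal P_R\subseteq\mathcal P$ be the $\widetilde K$-bundle of those $q$ for which the frame $\Lambda(q)$ is unitary. Put $\mathcal H=\mathcal P\times_\sigma H$, $\mathcal H^\bullet_R=\mathcal P_R\times_{\sigma^\bullet}H^\bullet$ (the reduced higher oscillator bundle) and $\mathcal{CH}_R=\mathcal P_R\times_\rho CH$. For $q\in\mathcal P_R$ over $m$, $\alpha\in\bigwedge^kT_m^*M$ and $h=[(q,u)]\in\mathcal H_m$, write $\alpha\otimes h=[(q,\Lambda(q)^*\alpha\otimes u)]\in(\mathcal H_R^\bullet)_m$.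 Let $J:\mathcal H\to\underline H=M\times H$ be a Kuiper map, i.e. a homeomorphism over $M$ that is unitary on each fibre. It induces $\check J([(q,v)])=\big(J([(q,v^\flat)])\big)^\sharp$ and the trivialization $J_{CH}:\mathcal{CH}_R\to M\times CH$ determined by $[(q,v\otimes f)]\mapsto\big(m,\mathrm{pr}_2\check J([(q,v)])\otimes\mathrm{pr}_2J([(q,f)])\big)$. With the pointwise operations $[(q,f)]\cdot[(q,a)]=[(q,f\cdot a)]$ and $([(q,f)],[(q,h)])_{\mathcal{CH}}=[(q,(f,h))]$, the bundle $\mathcal H^\bullet_R$ carries the $CH$-action $h\cdot a=h\cdot J_{CH}^{-1}(m,a)$ and the $CH$-valued product $(f,h)=\mathrm{pr}_2J_{CH}\big((f,h)_{\mathcal{CH}}\big)$; its smooth structure is given by the tensor products of the smooth charts of $\bigwedge^\bullet T^*M$ with the charts $\mu J$, $\mu\in\mathbb C^\times$. The bundle $\bigwedge^\bullet T^*M\otimes\underline H$ carries the action $(\alpha\otimes(m,u))\cdot a=\alpha\otimes(m,u\circ a)$, the product $(\alpha\otimes(m,u),\beta\otimes(m,v))=g(\alpha,\beta)\,u^\sharp\otimes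 v$, and the smooth structure given by the tensor products of the smooth charts of $\bigwedge^\bullet T^*M$ with the charts $\mu\,\mathrm{Id}$ of $\underline H$, $\mu\in\mathbb C^\times$. **Lemma 11.** The Kuiper map $J$ extends to a unitary isomorphism of Hilbert $CH$-bundles $$\widetilde J:\mathcal H^\bullet_R\longrightarrow\textstyle\bigwedge^\bullet T^*M\otimes\underline H .$$ That is, there is a homeomorphism $\widetilde J$ over $M$, complex linear on each fibre, with $$\widetilde J(\alpha\otimes h)=\alpha\otimes J(h)$$ for all $m\in M$, $0\le k\le 2n$, $\alpha\in\bigwedge^kT_m^*M$ and $h\in\mathcal H_m$; it satisfies $\widetilde J(x\cdot a)=\widetilde J(x)\cdot a$ and $(\widetilde J(x),\widetilde J(y))=(x,y)$ for all $x,y$ in the same fibre of $\mathcal H^\bullet_R$ and all $a\in CH$; and it is smooth with respect to the two smooth structures: in charts over open sets $U$, $U'$ it has the form $(m,f)\mapsto(m,\tau(m)f)$ for a smooth map $\tau$ from $U\cap U'$ to the bounded operators on $H^\bullet$, whose values are invertible and commute with the action of $CH$. -/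

import Mathlib

open MeasureTheory
open scoped Manifold ContDiff

set_option linter.unusedSectionVars false

noncomputable section

namespace Metaplectic

section Algebra

/-! ### Compact operators and the dual of a Hilbert space -/

variable (E : Type*) [NormedAddCommGroup E] [InnerProductSpace ℂ E] [CompleteSpace E]

/-- The algebra of compact operators on the Hilbert space `E`, with the operator norm. -/
def CH : Type _ := compactOperator (RingHom.id ℂ) E E

instance : NormedAddCommGroup (CH E) :=
  inferInstanceAs (NormedAddCommGroup (compactOperator (RingHom.id ℂ) E E))
instance : NormedSpace ℂ (CH E) :=
  inferInstanceAs (NormedSpace ℂ (compactOperator (RingHom.id ℂ) E E))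

/-- The continuous dual of the Hilbert space `E`, with the dual norm. -/
def HDual : Type _ := StrongDual ℂ E

instance : NormedAddCommGroup (HDual E) := inferInstanceAs (NormedAddCommGroup (StrongDual ℂ E))
instance : NormedSpace ℂ (HDual E) := inferInstanceAs (NormedSpace ℂ (StrongDual ℂ E))

variable {E}

/-- A functional, seen as a continuous linear map. -/
def HDual.toCLM (f : HDual E) : E →L[ℂ] ℂ := f

/-- A compact operator, seen as a bounded operator. -/
def CH.toCLM (a : CH E) : E →L[ℂ] E := a.1

theorem CH.ext {a b : CH E} (h : ∀ w, a.toCLM w = b.toCLM w) : a = b :=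
  Subtype.ext (ContinuousLinearMap.ext h)

/-- The composition of compact operators. -/
def CH.mul (a b : CH E) : CH E :=
  ⟨a.1.comp b.1, IsCompactOperator.clm_comp b.2 a.1⟩

/-- Conjugation of compact operators by a unitary operator, `a ↦ U ∘ a ∘ U⁻¹`. -/
def CH.conj (U : E ≃ₗᵢ[ℂ] E) : CH E ≃ₗ[ℂ] CH E where
  toFun a := ⟨(U : E →L[ℂ] E).comp (a.1.comp (U.symm : E →L[ℂ] E)),
    (IsCompactOperator.comp_clm a.2 (U.symm : E →L[ℂ] E)).clm_comp (U : E →L[ℂ] E)⟩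
  invFun a := ⟨(U.symm : E →L[ℂ] E).comp (a.1.comp (U : E →L[ℂ] E)),
    (IsCompactOperator.comp_clm a.2 (U : E →L[ℂ] E)).clm_comp (U.symm : E →L[ℂ] E)⟩
  map_add' a b := CH.ext fun w => U.map_add _ _
  map_smul' c a := CH.ext fun w => U.map_smul _ _
  left_inv a := CH.ext fun w => by
    change U.symm (U (a.toCLM (U.symm (U w)))) = a.toCLM w
    simp
  right_inv a := CH.ext fun w => by
    change U (U.symm (a.toCLM (U (U.symm w)))) = a.toCLM w
    simp

/-- `f ↦ f^♯`, the Riesz representative of a functional: `f v = ⟪f^♯, v⟫`. -/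
def sharp (f : HDual E) : E := (InnerProductSpace.toDual ℂ E).symm f

/-- `v ↦ v^♭`, the functional `⟪v, ·⟫`. -/
def flat (v : E) : HDual E := InnerProductSpace.toDual ℂ E v

/-- The rank one operator `u ⊗ f : w ↦ f w • u`. -/
def tens (u : E) (f : HDual E) : CH E :=
  ⟨f.toCLM.smulRight u, by
    have h : IsCompactOperator (ContinuousLinearMap.toSpanSingleton ℂ u) :=
      isCompactOperator_of_locallyCompactSpace_rng (ContinuousLinearMap.toSpanSingleton ℂ u)
    exact h.comp_clm f.toCLM⟩

/-- The right action of an operator on functionals, `u ↦ u ∘ a`. -/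
def precomp (a : E →L[ℂ] E) : HDual E →L[ℂ] HDual E :=
  (ContinuousLinearMap.compL ℂ E E ℂ).flip a

/-- The product `(u, v) ↦ u^♯ ⊗ v` of functionals, as a real bilinear map. -/
def dualProd : HDual E →ₗ[ℝ] HDual E →ₗ[ℝ] CH E :=
  LinearMap.mk₂ ℝ (fun u v => tens (sharp u) v)
    (fun u u' v => by
      have h : sharp (u + u') = sharp u + sharp u' :=
        map_add (InnerProductSpace.toDual ℂ E).symm u u'
      refine CH.ext fun w => ?_
      change v.toCLM w • sharp (u + u') = v.toCLM w • sharp u + v.toCLM w • sharp u'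
      rw [h, smul_add])
    (fun c u v => by
      have h : sharp (c • u) = (c : ℂ) • sharp u := by
        have := map_smulₛₗ (InnerProductSpace.toDual ℂ E).symm (c : ℂ) u
        rw [Complex.conj_ofReal] at this
        exact this
      refine CH.ext fun w => ?_
      change v.toCLM w • sharp (c • u) = ((c : ℂ) • (v.toCLM w • sharp u) : E)
      rw [h, smul_comm])
    (fun u v v' => by
      refine CH.ext fun w => ?_
      change (v.toCLM w + v'.toCLM w) • sharp u = v.toCLM w • sharp u + v'.toCLM w • sharp u
      rw [add_smul])
    (fun c u v => by
      refine CH.ext fun w => ?_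
      change ((c : ℂ) * v.toCLM w) • sharp u = ((c : ℂ) • (v.toCLM w • sharp u) : E)
      rw [mul_smul])

/-- The dual (contragredient) `u ↦ u ∘ U⁻¹` of a unitary operator `U`. -/
def dualUnitary (U : E ≃ₗᵢ[ℂ] E) : HDual E ≃ₗᵢ[ℂ] HDual E where
  toFun u := u.toCLM.comp (U.symm : E →L[ℂ] E)
  invFun u := u.toCLM.comp (U : E →L[ℂ] E)
  map_add' _ _ := rfl
  map_smul' _ _ := rfl
  left_inv u := by
    refine ContinuousLinearMap.ext fun w => ?_
    change u.toCLM (U.symm (U w)) = u.toCLM w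
    simp
  right_inv u := by
    refine ContinuousLinearMap.ext fun w => ?_
    change u.toCLM (U (U.symm w)) = u.toCLM w
    simp
  norm_map' u := ContinuousLinearMap.opNorm_comp_linearIsometryEquiv u.toCLM U.symm

/-- The unitary operator `♯ ∘ T ∘ ♭` of `E` that corresponds to a unitary operator `T` of the
dual. -/
def sharpConj (T : HDual E ≃ₗᵢ[ℂ] HDual E) : E ≃ₗᵢ[ℂ] E :=
  ((InnerProductSpace.toDual ℂ E).trans
    (show StrongDual ℂ E ≃ₗᵢ[ℂ] StrongDual ℂ E from T)).trans (InnerProductSpace.toDual ℂ E).symm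

theorem sharpConj_apply (T : HDual E ≃ₗᵢ[ℂ] HDual E) (v : E) :
    sharpConj T v = sharp (T (flat v)) := rfl

theorem HDual.toCLM_eq_inner (f : HDual E) (v : E) : f.toCLM v = inner ℂ (sharp f) v :=
  (InnerProductSpace.toDual_symm_apply (𝕜 := ℂ) (x := v) (y := f)).symm

theorem sharp_flat (v : E) : sharp (flat v) = v :=
  (InnerProductSpace.toDual ℂ E).symm_apply_apply v

theorem flat_sharp (f : HDual E) : flat (sharp f) = f :=
  (InnerProductSpace.toDual ℂ E).apply_symm_apply f

theorem sharp_dualUnitary (U : E ≃ₗᵢ[ℂ] E) (f : HDual E) :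
    sharp (dualUnitary U f) = U (sharp f) := by
  refine ext_inner_right ℂ fun v => ?_
  rw [← HDual.toCLM_eq_inner]
  change f.toCLM (U.symm v) = _
  rw [HDual.toCLM_eq_inner, ← U.inner_map_map (sharp f), U.apply_symm_apply]

theorem sharpConj_dualUnitary (U : E ≃ₗᵢ[ℂ] E) : sharpConj (dualUnitary U) = U := by
  ext v
  rw [sharpConj_apply, sharp_dualUnitary, sharp_flat]

theorem dualUnitary_sharpConj (T : HDual E ≃ₗᵢ[ℂ] HDual E) : dualUnitary (sharpConj T) = T := by
  ext f
  have : sharp (dualUnitary (sharpConj T) f) = sharp (T f) := by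
    rw [sharp_dualUnitary, sharpConj_apply, flat_sharp]
  exact (InnerProductSpace.toDual ℂ E).symm.injective this

theorem sharpConj_mul (T T' : HDual E ≃ₗᵢ[ℂ] HDual E) :
    sharpConj (T * T') = sharpConj T * sharpConj T' := by
  ext v
  change sharp (T (T' (flat v))) = sharp (T (flat (sharp (T' (flat v)))))
  rw [flat_sharp]

theorem dualUnitary_mul (U U' : E ≃ₗᵢ[ℂ] E) :
    dualUnitary (U * U') = dualUnitary U * dualUnitary U' := rfl

theorem dualUnitary_one : dualUnitary (1 : E ≃ₗᵢ[ℂ] E) = 1 := rfl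

theorem conj_mul (U U' : E ≃ₗᵢ[ℂ] E) : CH.conj (U * U') = CH.conj U * CH.conj U' := rfl

theorem conj_one : CH.conj (1 : E ≃ₗᵢ[ℂ] E) = 1 := rfl

theorem dualUnitary_precomp (U : E ≃ₗᵢ[ℂ] E) (a : CH E) (u : HDual E) :
    precomp (CH.conj U a).toCLM (dualUnitary U u) = dualUnitary U (precomp a.toCLM u) := by
  refine ContinuousLinearMap.ext fun w => ?_
  change u.toCLM (U.symm (U (a.toCLM (U.symm w)))) = u.toCLM (a.toCLM (U.symm w))
  simp

/-- On rank one operators, conjugation by `U` is `u ⊗ f ↦ U u ⊗ (f ∘ U⁻¹)`. -/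
theorem conj_tens (U : E ≃ₗᵢ[ℂ] E) (u : E) (f : HDual E) :
    CH.conj U (tens u f) = tens (U u) (dualUnitary U f) := by
  refine CH.ext fun w => ?_
  exact U.map_smul (f.toCLM (U.symm w)) u

theorem dualProd_dualUnitary (U : E ≃ₗᵢ[ℂ] E) (u v : HDual E) :
    dualProd (dualUnitary U u) (dualUnitary U v) = CH.conj U (dualProd u v) := by
  change tens (sharp _) _ = CH.conj U (tens (sharp u) v)
  rw [conj_tens, sharp_dualUnitary]

end Algebra

section Forms

/-! ### Alternating forms with values in a vector space

For a finite dimensional real vector space `W`, the tensor product `⋀^k W* ⊗ X` is realised as the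
space `W [⋀^Fin k]→L[ℝ] X` of alternating `k`-forms on `W` with values in `X`; the elementary tensor
`α ⊗ u` is the form `w ↦ α w • u` (`ContinuousAlternatingMap.smulRight`). -/

variable {W W' W'' X X' X'' Y Y' : Type*}
  [AddCommGroup W] [Module ℝ W] [TopologicalSpace W]
  [AddCommGroup W'] [Module ℝ W'] [TopologicalSpace W']
  [AddCommGroup W''] [Module ℝ W''] [TopologicalSpace W'']

section Pairing

variable [AddCommGroup X] [Module ℝ X] [TopologicalSpace X]
  [AddCommGroup X'] [Module ℝ X'] [TopologicalSpace X']
  [AddCommGroup Y] [Module ℝ Y] [AddCommGroup Y'] [Module ℝ Y']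
variable [Module.Finite ℝ W]

/-- Given a scalar product `g` on `W` and a bilinear map `B` on `X`, this is the bilinear map
`(α ⊗ u, β ⊗ v) ↦ g(α, β) • B u v` on `X`-valued `k`-forms, where `g(α, β)` is the scalar product
of `k`-forms induced by `g`. In a basis `b` of `W`, with `(g^{ij})` the inverse of the matrix
`(g(b_i, b_j))`, it is
`(1 / k!) ∑ g^{i₁ j₁} ⋯ g^{i_k j_k} B (φ(b_{i₁}, …, b_{i_k})) (ψ(b_{j₁}, …, b_{j_k}))`. -/
def formPairing (g : W →L[ℝ] W →L[ℝ] ℝ) (B : X →ₗ[ℝ] X →ₗ[ℝ] Y) {k : ℕ}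
    (φ ψ : W [⋀^Fin k]→L[ℝ] X) : Y :=
  ((k.factorial : ℝ)⁻¹) • ∑ I : Fin k → Fin (Module.finrank ℝ W),
    ∑ J : Fin k → Fin (Module.finrank ℝ W),
      (∏ l, (Matrix.of fun i j => g (Module.finBasis ℝ W i) (Module.finBasis ℝ W j))⁻¹ (I l) (J l)) •
        B (φ fun l => Module.finBasis ℝ W (I l)) (ψ fun l => Module.finBasis ℝ W (J l))

/-- The scalar product (of Hodge type) on scalar `k`-forms induced by a scalar product on `W`. -/
def hodge (g : W →L[ℝ] W →L[ℝ] ℝ) {k : ℕ} (α β : W [⋀^Fin k]→L[ℝ] ℝ) : ℝ :=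
  formPairing g (LinearMap.mul ℝ ℝ) α β

theorem formPairing_smulRight [ContinuousSMul ℝ X] (g : W →L[ℝ] W →L[ℝ] ℝ)
    (B : X →ₗ[ℝ] X →ₗ[ℝ] Y) {k : ℕ} (α β : W [⋀^Fin k]→L[ℝ] ℝ) (u v : X) :
    formPairing g B (α.smulRight u) (β.smulRight v) = hodge g α β • B u v := by
  simp only [hodge, formPairing, ContinuousAlternatingMap.smulRight_apply, map_smul,
    LinearMap.smul_apply, LinearMap.mul_apply', smul_eq_mul, Finset.sum_smul, mul_smul,
    Finset.smul_sum]
  exact Finset.sum_congr rfl fun I _ => Finset.sum_congr rfl fun J _ => by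
    rw [smul_comm (β _) (α _)]

theorem formPairing_comp (g : W →L[ℝ] W →L[ℝ] ℝ) (B : X →ₗ[ℝ] X →ₗ[ℝ] Y) (A : W ≃L[ℝ] W)
    (hA : ∀ u v, g (A u) (A v) = g u v) {k : ℕ} (φ ψ : W [⋀^Fin k]→L[ℝ] X) :
    formPairing g B (φ.compContinuousLinearMap (A : W →L[ℝ] W))
      (ψ.compContinuousLinearMap (A : W →L[ℝ] W)) = formPairing g B φ ψ := by
  set b := Module.finBasis ℝ W with hb
  set G : Matrix _ _ ℝ := Matrix.of fun i j => g (b i) (b j) with hG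
  set a : Matrix _ _ ℝ := Matrix.of fun i j => b.repr (A (b j)) i with ha
  have hAb : ∀ j, A (b j) = ∑ i, a i j • b i := fun j => (b.sum_repr (A (b j))).symm
  have haM : a = LinearMap.toMatrix b b (A : W →ₗ[ℝ] W) := by
    ext i j; simp [ha, LinearMap.toMatrix_apply]
  have hdet : IsUnit a.det := by
    rw [haM]
    exact LinearEquiv.isUnit_det A.toLinearEquiv b b
  have hGa : a.transpose * G * a = G := by
    ext i j
    have h := hA (b i) (b j)
    rw [hAb, hAb] at h
    simp only [map_sum, map_smul, sum_apply, smul_apply,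
      smul_eq_mul] at h
    simp only [Matrix.mul_apply, Matrix.transpose_apply, hG, Matrix.of_apply]
    rw [← h]
    refine Finset.sum_congr rfl fun x _ => ?_
    rw [Finset.sum_mul, Finset.mul_sum]
    refine Finset.sum_congr rfl fun y _ => by ring
  have hP : a * G⁻¹ * a.transpose = G⁻¹ := by
    have hdet' : IsUnit a.transpose.det := by rwa [Matrix.det_transpose]
    conv_lhs => rw [← hGa]
    rw [Matrix.mul_inv_rev, Matrix.mul_inv_rev, ← Matrix.mul_assoc,
      Matrix.mul_nonsing_inv _ hdet, Matrix.one_mul, Matrix.mul_assoc,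
      Matrix.nonsing_inv_mul _ hdet', Matrix.mul_one]
  have key : ∀ (χ : W [⋀^Fin k]→L[ℝ] X) (I : Fin k → Fin (Module.finrank ℝ W)),
      (χ.compContinuousLinearMap (A : W →L[ℝ] W)) (fun l => b (I l)) =
        ∑ I' : Fin k → Fin (Module.finrank ℝ W),
          (∏ l, a (I' l) (I l)) • χ (fun l => b (I' l)) := by
    intro χ I
    have h1 : (χ.compContinuousLinearMap (A : W →L[ℝ] W)) (fun l => b (I l)) =
        χ.toMultilinearMap (fun l => ∑ i, a i (I l) • b i) := by
      change χ (fun l => A (b (I l))) = χ (fun l => ∑ i, a i (I l) • b i)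
      exact congrArg χ (funext fun l => hAb (I l))
    rw [h1, MultilinearMap.map_sum]
    exact Finset.sum_congr rfl fun I' _ => χ.toMultilinearMap.map_smul_univ _ _
  have hprod : ∀ I' J' : Fin k → Fin (Module.finrank ℝ W),
      ∏ l, G⁻¹ (I' l) (J' l) = ∑ I : Fin k → Fin (Module.finrank ℝ W),
        ∑ J : Fin k → Fin (Module.finrank ℝ W), (∏ l, G⁻¹ (I l) (J l)) *
          ((∏ l, a (I' l) (I l)) * ∏ l, a (J' l) (J l)) := by
    intro I' J'
    have h1 : ∀ l, G⁻¹ (I' l) (J' l) = ∑ i, ∑ j, G⁻¹ i j * (a (I' l) i * a (J' l) j) := by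
      intro l
      conv_lhs => rw [← hP]
      simp only [Matrix.mul_apply, Matrix.transpose_apply, Finset.sum_mul]
      rw [Finset.sum_comm]
      exact Finset.sum_congr rfl fun i _ => Finset.sum_congr rfl fun j _ => by ring
    simp only [h1]
    rw [Finset.prod_univ_sum, Fintype.piFinset_univ]
    refine Finset.sum_congr rfl fun I _ => ?_
    rw [Finset.prod_univ_sum, Fintype.piFinset_univ]
    refine Finset.sum_congr rfl fun J _ => ?_
    rw [Finset.prod_mul_distrib, Finset.prod_mul_distrib]
  unfold formPairing
  congr 1
  simp only [← hb, ← hG, key, map_sum, map_smul, LinearMap.sum_apply, LinearMap.smul_apply,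
    Finset.smul_sum, smul_smul]
  calc _ = ∑ I : Fin k → Fin (Module.finrank ℝ W), ∑ J : Fin k → Fin (Module.finrank ℝ W),
        ∑ I' : Fin k → Fin (Module.finrank ℝ W), ∑ J' : Fin k → Fin (Module.finrank ℝ W),
          ((∏ l, G⁻¹ (I l) (J l)) * ((∏ l, a (I' l) (I l)) * ∏ l, a (J' l) (J l))) •
            B (φ fun l => b (I' l)) (ψ fun l => b (J' l)) := by
        refine Finset.sum_congr rfl fun I _ => Finset.sum_congr rfl fun J _ => ?_
        rw [Finset.sum_comm]
        refine Finset.sum_congr rfl fun I' _ => Finset.sum_congr rfl fun J' _ => ?_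
        congr 1
        ring
    _ = ∑ I' : Fin k → Fin (Module.finrank ℝ W), ∑ J' : Fin k → Fin (Module.finrank ℝ W),
          ∑ I : Fin k → Fin (Module.finrank ℝ W), ∑ J : Fin k → Fin (Module.finrank ℝ W),
          ((∏ l, G⁻¹ (I l) (J l)) * ((∏ l, a (I' l) (I l)) * ∏ l, a (J' l) (J l))) •
            B (φ fun l => b (I' l)) (ψ fun l => b (J' l)) := by
        have e1 : ∀ F : (Fin k → Fin (Module.finrank ℝ W)) → (Fin k → Fin (Module.finrank ℝ W)) →
            (Fin k → Fin (Module.finrank ℝ W)) → (Fin k → Fin (Module.finrank ℝ W)) → Y,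
            ∑ I, ∑ J, ∑ I', ∑ J', F I J I' J' = ∑ I', ∑ J', ∑ I, ∑ J, F I J I' J' := by
          intro F
          calc _ = ∑ I, ∑ I', ∑ J, ∑ J', F I J I' J' :=
                Finset.sum_congr rfl fun I _ => Finset.sum_comm
            _ = ∑ I', ∑ I, ∑ J, ∑ J', F I J I' J' := Finset.sum_comm
            _ = ∑ I', ∑ I, ∑ J', ∑ J, F I J I' J' :=
                Finset.sum_congr rfl fun I' _ => Finset.sum_congr rfl fun I _ => Finset.sum_comm
            _ = _ := Finset.sum_congr rfl fun I' _ => Finset.sum_comm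
        exact e1 _
    _ = _ := by
        refine Finset.sum_congr rfl fun I' _ => Finset.sum_congr rfl fun J' _ => ?_
        rw [hprod I' J', Finset.sum_smul]
        exact Finset.sum_congr rfl fun I _ => (Finset.sum_smul ..).symm

theorem formPairing_map (g : W →L[ℝ] W →L[ℝ] ℝ) (B : X →ₗ[ℝ] X →ₗ[ℝ] Y)
    (B' : X' →ₗ[ℝ] X' →ₗ[ℝ] Y') (T : X →L[ℝ] X') (R : Y →ₗ[ℝ] Y')
    (h : ∀ u v, B' (T u) (T v) = R (B u v)) {k : ℕ} (φ ψ : W [⋀^Fin k]→L[ℝ] X) :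
    formPairing g B' (T.compContinuousAlternatingMap φ) (T.compContinuousAlternatingMap ψ) =
      R (formPairing g B φ ψ) := by
  simp [formPairing, h, map_sum, map_smul]

end Pairing


/-- `⨁_{k = 0}^N ⋀^k W* ⊗ X`. -/
abbrev Forms (N : ℕ) (W X : Type*) [AddCommGroup W] [Module ℝ W] [TopologicalSpace W]
    [AddCommGroup X] [Module ℝ X] [TopologicalSpace X] : Type _ :=
  ∀ k : Fin (N + 1), W [⋀^Fin k]→L[ℝ] X

variable [NormedAddCommGroup X] [NormedSpace ℂ X] [NormedAddCommGroup X'] [NormedSpace ℂ X']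
  [NormedAddCommGroup X''] [NormedSpace ℂ X''] {N : ℕ}

/-- The map `⋀ A* ⊗ T : α ⊗ u ↦ (A* α) ⊗ T u` of forms, for `A : W' → W` and `T : X → X'`. -/
def Forms.map (A : W' →L[ℝ] W) (T : X →L[ℂ] X') (f : Forms N W X) : Forms N W' X' := fun k =>
  ((T.restrictScalars ℝ).compContinuousAlternatingMap (f k)).compContinuousLinearMap A

/-- The form `α ⊗ u` of degree `k`. -/
def Forms.tmul {k : Fin (N + 1)} (α : W [⋀^Fin k]→L[ℝ] ℝ) (u : X) : Forms N W X :=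
  Pi.single k (α.smulRight u)

theorem Forms.map_tmul (A : W' →L[ℝ] W) (T : X →L[ℂ] X') {k : Fin (N + 1)}
    (α : W [⋀^Fin k]→L[ℝ] ℝ) (u : X) :
    Forms.map A T (Forms.tmul (N := N) α u) =
      Forms.tmul (α.compContinuousLinearMap A) (T u) := by
  funext j
  ext w
  rcases eq_or_ne j k with rfl | h
  · simp [Forms.map, Forms.tmul]
  · simp [Forms.map, Forms.tmul, h]

theorem Forms.map_add (A : W' →L[ℝ] W) (T : X →L[ℂ] X') (f f' : Forms N W X) :
    Forms.map A T (f + f') = Forms.map A T f + Forms.map A T f' := by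
  funext j
  ext w
  simp [Forms.map]

theorem Forms.map_smul (A : W' →L[ℝ] W) (T : X →L[ℂ] X') (c : ℂ) (f : Forms N W X) :
    Forms.map A T (c • f) = c • Forms.map A T f := by
  funext j
  ext w
  simp [Forms.map]

theorem Forms.map_id (f : Forms N W X) :
    Forms.map (ContinuousLinearMap.id ℝ W) (ContinuousLinearMap.id ℂ X) f = f := by
  funext j
  ext w
  simp [Forms.map]

theorem Forms.map_map (A : W' →L[ℝ] W) (A' : W'' →L[ℝ] W') (T : X →L[ℂ] X') (T' : X' →L[ℂ] X'')
    (f : Forms N W X) :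
    Forms.map A' T' (Forms.map A T f) = Forms.map (A.comp A') (T'.comp T) f := by
  funext j
  ext w
  rfl

variable {E : Type*} [NormedAddCommGroup E] [InnerProductSpace ℂ E] [CompleteSpace E]

/-- The right action `(α ⊗ u) · a = α ⊗ (u ∘ a)` of the compact operators. -/
def Forms.act (f : Forms N W (HDual E)) (a : CH E) : Forms N W (HDual E) :=
  Forms.map (ContinuousLinearMap.id ℝ W) (precomp a.toCLM) f

/-- The product `(α ⊗ u, β ⊗ v) = g(α, β) u^♯ ⊗ v` with values in the compact operators; forms of
different degrees are orthogonal. -/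
def Forms.prod [Module.Finite ℝ W] (g : W →L[ℝ] W →L[ℝ] ℝ) (f h : Forms N W (HDual E)) : CH E :=
  ∑ k, formPairing g dualProd (f k) (h k)

/-- The right module structure is compatible with unitary operators. -/
theorem Forms.map_act (A : W' →L[ℝ] W) (U : E ≃ₗᵢ[ℂ] E) (f : Forms N W (HDual E)) (a : CH E) :
    (Forms.map A (dualUnitary U : HDual E →L[ℂ] HDual E) f).act (CH.conj U a) =
      Forms.map A (dualUnitary U : HDual E →L[ℂ] HDual E) (f.act a) := by
  unfold Forms.act
  rw [Forms.map_map, Forms.map_map]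
  congr 1
  ext1 u
  exact dualUnitary_precomp U a u

theorem Forms.prod_map [Module.Finite ℝ W] (g : W →L[ℝ] W →L[ℝ] ℝ) (A : W ≃L[ℝ] W)
    (hA : ∀ u v, g (A u) (A v) = g u v) (U : E ≃ₗᵢ[ℂ] E) (f h : Forms N W (HDual E)) :
    Forms.prod g (Forms.map (A : W →L[ℝ] W) (dualUnitary U : HDual E →L[ℂ] HDual E) f)
      (Forms.map (A : W →L[ℝ] W) (dualUnitary U : HDual E →L[ℂ] HDual E) h) =
      CH.conj U (Forms.prod g f h) := by
  have hc : ∀ x : CH E, (CH.conj U).toLinearMap.restrictScalars ℝ x = CH.conj U x := fun _ => rfl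
  unfold Forms.prod
  rw [map_sum]
  refine Finset.sum_congr rfl fun k _ => ?_
  refine (formPairing_comp g dualProd A hA _ _).trans ?_
  rw [← hc]
  refine formPairing_map g dualProd dualProd
    ((dualUnitary U : HDual E →L[ℂ] HDual E).restrictScalars ℝ)
    ((CH.conj U).toLinearMap.restrictScalars ℝ) ?_ (f k) (h k)
  intro u v
  exact dualProd_dualUnitary U u v

end Forms

section Assoc

/-! ### Principal bundles and associated bundles -/

/-- A (locally trivial) principal bundle `π : P → M` with structure group `G` acting on `P` from the
right. -/
structure IsPrincipalBundle (G : Type*) [Group G] [TopologicalSpace G] {P M : Type*}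
    [TopologicalSpace P] [TopologicalSpace M] [MulAction Gᵐᵒᵖ P] (π : P → M) : Prop where
  continuous_action : Continuous fun x : P × G => MulOpposite.op x.2 • x.1
  proj_action : ∀ (p : P) (g : G), π (MulOpposite.op g • p) = π p
  locally_trivial : ∀ m : M, ∃ e : Bundle.Trivialization G π, m ∈ e.baseSet ∧
    ∀ p : P, π p ∈ e.baseSet → ∀ g : G, (e (MulOpposite.op g • p)).2 = (e p).2 * g

/-- The group acts on the fibres of `π`, freely and transitively. -/
structure SimplyTransitive (G : Type*) [Group G] {P M : Type*} [MulAction Gᵐᵒᵖ P] (π : P → M) :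
    Prop where
  proj_action : ∀ (p : P) (g : G), π (MulOpposite.op g • p) = π p
  existsUnique : ∀ p q : P, π p = π q → ∃! g : G, q = MulOpposite.op g • p

theorem IsPrincipalBundle.simplyTransitive {G : Type*} [Group G] [TopologicalSpace G] {P M : Type*}
    [TopologicalSpace P] [TopologicalSpace M] [MulAction Gᵐᵒᵖ P] {π : P → M}
    (h : IsPrincipalBundle G π) : SimplyTransitive G π where
  proj_action := h.proj_action
  existsUnique p q hpq := by
    obtain ⟨e, he, h2⟩ := h.locally_trivial (π p)
    have hinj : ∀ r s : P, π r = π p → π s = π p → (e r).2 = (e s).2 → r = s := by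
      intro r s hr hs hrs
      have hr' : r ∈ e.source := e.mem_source.2 (hr ▸ he)
      have hs' : s ∈ e.source := e.mem_source.2 (hs ▸ he)
      refine e.injOn hr' hs' (Prod.ext ?_ hrs)
      exact (e.coe_fst hr').trans ((hr.trans hs.symm).trans (e.coe_fst hs').symm)
    refine ⟨(e p).2⁻¹ * (e q).2, ?_, ?_⟩
    · refine hinj _ _ hpq.symm (h.proj_action _ _) ?_
      rw [h2 p he]
      group
    · intro g hg
      rw [hg, h2 p he]
      group

variable {G P X Y Z M : Type*} [Group G] [MulAction Gᵐᵒᵖ P]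
  [AddCommGroup X] [Module ℂ X] [AddCommGroup Y] [Module ℂ Y] [AddCommGroup Z] [Module ℂ Z]

/-- The equivalence relation `(p, x) ∼ (p g⁻¹, κ(g) x)` on `P × X`. -/
def assocSetoid (P : Type*) [MulAction Gᵐᵒᵖ P] (κ : G →* (X ≃ₗ[ℂ] X)) : Setoid (P × X) where
  r x y := ∃ g : G, y.1 = MulOpposite.op g⁻¹ • x.1 ∧ y.2 = κ g x.2
  iseqv :=
    { refl := fun x => ⟨1, by simp, by simp⟩
      symm := by
        rintro x y ⟨g, h1, h2⟩
        refine ⟨g⁻¹, ?_, ?_⟩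
        · rw [h1, smul_smul, ← MulOpposite.op_mul]; simp
        · rw [h2, ← LinearEquiv.mul_apply, ← map_mul]; simp
      trans := by
        rintro x y z ⟨g, h1, h2⟩ ⟨g', h1', h2'⟩
        refine ⟨g' * g, ?_, ?_⟩
        · rw [h1', h1, smul_smul, ← MulOpposite.op_mul]; simp
        · rw [h2', h2, map_mul, LinearEquiv.mul_apply] }

/-- The total space `P ×_κ X` of the bundle associated to `P` by the representation `κ`. -/
def Assoc (P : Type*) [MulAction Gᵐᵒᵖ P] (κ : G →* (X ≃ₗ[ℂ] X)) : Type _ :=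
  Quotient (assocSetoid P κ)

/-- The associated bundle carries the quotient topology. -/
instance [TopologicalSpace P] [TopologicalSpace X] (κ : G →* (X ≃ₗ[ℂ] X)) :
    TopologicalSpace (Assoc P κ) :=
  inferInstanceAs (TopologicalSpace (Quotient (assocSetoid P κ)))

namespace Assoc

variable {κ : G →* (X ≃ₗ[ℂ] X)} {κ' : G →* (Y ≃ₗ[ℂ] Y)} {κ'' : G →* (Z ≃ₗ[ℂ] Z)}

/-- The class `[(p, x)]`. -/
def mk (κ : G →* (X ≃ₗ[ℂ] X)) (p : P) (x : X) : Assoc P κ := Quotient.mk (assocSetoid P κ) (p, x)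

theorem mk_action (p : P) (g : G) (x : X) :
    mk κ (MulOpposite.op g • p) x = mk κ p (κ g x) :=
  Quotient.sound ⟨g, by simp, rfl⟩

variable {π : P → M}

theorem ind {C : Assoc P κ → Prop} (h : ∀ p x, C (mk κ p x)) (y : Assoc P κ) : C y :=
  Quotient.ind (fun z => h z.1 z.2) y

/-- The bundle projection `[(p, x)] ↦ π p`. -/
def proj (hπ : SimplyTransitive G π) (y : Assoc P κ) : M :=
  Quotient.liftOn y (fun z => π z.1) (by
    rintro z z' ⟨g, h1, _⟩
    rw [h1, hπ.proj_action])

theorem proj_mk (hπ : SimplyTransitive G π) (p : P) (x : X) : proj hπ (mk κ p x) = π p := rfl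

theorem exists_rep (hπ : SimplyTransitive G π) (y : Assoc P κ) (p : P) (h : π p = proj hπ y) :
    ∃ x, y = mk κ p x := by
  induction y using Quotient.inductionOn with
  | h z =>
    obtain ⟨q, x⟩ := z
    obtain ⟨g, hg, -⟩ := hπ.existsUnique p q h
    refine ⟨κ g x, ?_⟩
    rw [← mk_action, ← hg]
    rfl

theorem mk_inj (hπ : SimplyTransitive G π) {p : P} {x x' : X} (h : mk κ p x = mk κ p x') :
    x = x' := by
  obtain ⟨g, h1, h2⟩ := Quotient.exact h
  have h1' : p = MulOpposite.op g⁻¹ • p := h1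
  have : g⁻¹ = 1 := (hπ.existsUnique p p rfl).unique h1' (by simp)
  have hg : g = 1 := by simpa using this
  have h2' : x' = κ g x := h2
  rw [h2', hg]
  simp

/-- The function `[(p, x)] ↦ F p x` induced by an invariant function `F`. -/
def lift {T : Type*} (F : P → X → T)
    (hF : ∀ p (g : G) x, F (MulOpposite.op g • p) x = F p (κ g x)) (y : Assoc P κ) : T :=
  Quotient.liftOn y (fun z => F z.1 z.2) (by
    rintro ⟨p, x⟩ ⟨p', x'⟩ ⟨g, h1, h2⟩
    obtain rfl : p = MulOpposite.op g • p' := by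
      rw [show p' = MulOpposite.op g⁻¹ • p from h1, smul_smul, ← MulOpposite.op_mul]
      simp
    obtain rfl : x' = κ g x := h2
    exact hF p' g x)

theorem lift_mk {T : Type*} (F : P → X → T)
    (hF : ∀ p (g : G) x, F (MulOpposite.op g • p) x = F p (κ g x)) (p : P) (x : X) :
    lift (κ := κ) F hF (mk κ p x) = F p x := rfl

/-- A representative `(p, x)` of a class `[(p, x)]`. -/
def rep (y : Assoc P κ) : P × X := Quotient.out y

theorem mk_rep (y : Assoc P κ) : mk κ y.rep.1 y.rep.2 = y := Quotient.out_eq y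

/-- The vector `x` such that `y = [(p, x)]`, for `p` in the fibre over the base point of `y`. -/
def coord (hπ : SimplyTransitive G π) (y : Assoc P κ) (p : P) (h : π p = proj hπ y) : X :=
  (exists_rep hπ y p h).choose

theorem mk_coord (hπ : SimplyTransitive G π) (y : Assoc P κ) (p : P) (h : π p = proj hπ y) :
    mk κ p (coord hπ y p h) = y :=
  (exists_rep hπ y p h).choose_spec.symm

/-- The fibrewise map `([(p, x)], [(p, y)]) ↦ [(p, b x y)]` induced by an equivariant map `b`. It is
defined by means of a representative and does not depend on its choice by `map₂_mk`. -/
def map₂ (hπ : SimplyTransitive G π) (κ'' : G →* (Z ≃ₗ[ℂ] Z)) (b : X → Y → Z)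
    (x : Assoc P κ) (y : Assoc P κ') (h : proj hπ x = proj hπ y) : Assoc P κ'' :=
  mk κ'' x.rep.1 (b x.rep.2 (coord hπ y x.rep.1
    (by rw [← h, ← proj_mk hπ (κ := κ) x.rep.1 x.rep.2, mk_rep])))

theorem map₂_mk (hπ : SimplyTransitive G π) (b : X → Y → Z)
    (hb : ∀ g x y, b (κ g x) (κ' g y) = κ'' g (b x y)) (p : P) (x : X) (y : Y)
    (h : proj hπ (mk κ p x) = proj hπ (mk κ' p y)) :
    map₂ hπ κ'' b (mk κ p x) (mk κ' p y) h = mk κ'' p (b x y) := by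
  have hq : π (mk κ p x).rep.1 = π p := by
    rw [← proj_mk hπ (κ := κ) _ (mk κ p x).rep.2, mk_rep]
    rfl
  obtain ⟨g, hg, -⟩ := hπ.existsUnique (mk κ p x).rep.1 p hq
  have hx : (mk κ p x).rep.2 = κ g x := by
    apply mk_inj hπ (p := (mk κ p x).rep.1)
    rw [mk_rep, ← mk_action, ← hg]
  have hy : coord hπ (mk κ' p y) (mk κ p x).rep.1 hq = κ' g y := by
    apply mk_inj hπ (p := (mk κ p x).rep.1)
    refine (mk_coord (κ := κ') hπ (mk κ' p y) (mk κ p x).rep.1 hq).trans ?_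
    rw [← mk_action, ← hg]
  unfold map₂
  rw [hx, hy, hb, ← mk_action, ← hg]

end Assoc

end Assoc

section Model

/-! ### The symplectic vector space, the metaplectic group and its Segal-Shale-Weil representation -/

/-- A real symplectic vector space `(V, ω₀)` of dimension `2n` with a compatible positive complex
structure `J₀` and a Lagrangian subspace `L`. The inner product of `V` is the scalar product
`g₀(u, v) = ω₀(J₀ u, v)`. -/
structure SymplecticModel (n : ℕ) (V : Type*) [NormedAddCommGroup V] [InnerProductSpace ℝ V] where
  form : V →L[ℝ] V →L[ℝ] ℝ
  J : V →L[ℝ] V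
  L : Submodule ℝ V
  finrank_eq : Module.finrank ℝ V = 2 * n
  form_self : ∀ u, form u u = 0
  J_J : ∀ u, J (J u) = -u
  inner_eq : ∀ u v, inner ℝ u v = form (J u) v
  L_isotropic : ∀ u ∈ L, ∀ v ∈ L, form u v = 0
  finrank_L : Module.finrank ℝ L = n

variable {n : ℕ} {V : Type*} [NormedAddCommGroup V] [InnerProductSpace ℝ V]

namespace SymplecticModel

variable (S : SymplecticModel n V)

/-- The symplectic group `Sp(V, ω₀)`, with the topology of the group of invertible operators. -/
def Sp : Subgroup (V →L[ℝ] V)ˣ where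
  carrier := {A | ∀ u v, S.form (A.1 u) (A.1 v) = S.form u v}
  one_mem' := fun _ _ => rfl
  mul_mem' := by
    intro A B hA hB u v
    exact (hA _ _).trans (hB _ _)
  inv_mem' := by
    intro A hA u v
    have h : ∀ w, A.1 (A⁻¹.1 w) = w := fun w => DFunLike.congr_fun A.mul_inv w
    have := hA (A⁻¹.1 u) (A⁻¹.1 v)
    rw [h, h] at this
    exact this.symm

/-- The unitary group `O(V, g₀) ∩ Sp(V, ω₀)`. -/
def U : Subgroup S.Sp where
  carrier := {A | ∀ u v, inner ℝ (A.1.1 u) (A.1.1 v) = inner ℝ u v}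
  one_mem' := fun _ _ => rfl
  mul_mem' := by
    intro A B hA hB u v
    exact (hA _ _).trans (hB _ _)
  inv_mem' := by
    intro A hA u v
    have h : ∀ w, A.1.1 (A⁻¹.1.1 w) = w := fun w => DFunLike.congr_fun A.1.mul_inv w
    have := hA (A⁻¹.1.1 u) (A⁻¹.1.1 v)
    rw [h, h] at this
    exact this.symm

/-- An element of the symplectic group as a linear homeomorphism of `V`. -/
def toEquiv (A : S.Sp) : V ≃L[ℝ] V := ContinuousLinearEquiv.ofUnit A.1

theorem form_nondegenerate {u : V} (h : ∀ v, S.form u v = 0) : u = 0 := by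
  have h1 : inner ℝ (-S.J u) (-S.J u) = (0 : ℝ) := by
    rw [S.inner_eq, S.J.map_neg, S.J_J, neg_neg]
    exact h _
  have h2 : S.J u = 0 := by simpa using h1
  have h3 := S.J_J u
  rw [h2, map_zero] at h3
  simpa using h3.symm

/-- A symplectic map is unitary if and only if it commutes with the complex structure. -/
theorem mem_U_iff (A : S.Sp) : A ∈ S.U ↔ ∀ u, S.toEquiv A (S.J u) = S.J (S.toEquiv A u) := by
  have hA : ∀ u v, S.form (S.toEquiv A u) (S.toEquiv A v) = S.form u v := A.2
  constructor
  · intro h u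
    have h' : ∀ u v, inner ℝ (S.toEquiv A u) (S.toEquiv A v) = inner ℝ u v := h
    rw [← sub_eq_zero]
    refine S.form_nondegenerate fun v => ?_
    obtain ⟨w, rfl⟩ := (S.toEquiv A).surjective v
    rw [map_sub, sub_apply, hA, ← S.inner_eq, ← S.inner_eq, h', sub_self]
  · intro h u v
    change inner ℝ (S.toEquiv A u) (S.toEquiv A v) = inner ℝ u v
    rw [S.inner_eq, S.inner_eq, ← h, hA]

variable [FiniteDimensional ℝ V] [MeasurableSpace V] [BorelSpace V]

/-- The Hilbert space `L²(L)` of complex valued square integrable functions on the Lagrangian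
subspace `L`, with respect to the Lebesgue measure given by `g₀`. -/
def Hilb : Type _ := Lp ℂ 2 (volume : Measure S.L)

instance : NormedAddCommGroup S.Hilb :=
  inferInstanceAs (NormedAddCommGroup (Lp ℂ 2 (volume : Measure S.L)))
instance : InnerProductSpace ℂ S.Hilb :=
  inferInstanceAs (InnerProductSpace ℂ (Lp ℂ 2 (volume : Measure S.L)))
instance : CompleteSpace S.Hilb :=
  inferInstanceAs (CompleteSpace (Lp ℂ 2 (volume : Measure S.L)))

/-- The operator `f ↦ (q ↦ exp(i t (g₀(y, q) - g₀(x, y) / 2)) f(q - x))` of the Schrödinger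
representation with the real parameter `t`, for the vector `v = x + J₀ y` with `x, y ∈ L`. The
vectors `x` and `y` are the orthogonal projections to `L` of `v` and of `-J₀ v`. -/
def weyl (t : ℝ) (v : V) (f : S.Hilb) : S.Hilb :=
  MemLp.toLp (p := 2) (μ := (volume : Measure S.L))
    (fun q : S.L =>
      Complex.exp (((t * (inner ℝ (S.L.orthogonalProjectionOnto (-S.J v)) q -
        inner ℝ (S.L.orthogonalProjectionOnto v) (S.L.orthogonalProjectionOnto (-S.J v)) / 2) : ℝ) : ℂ) *
          Complex.I) *
        (show Lp ℂ 2 (volume : Measure S.L) from f) (q - S.L.orthogonalProjectionOnto v)) (by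
    have h1 := (Lp.memLp (show Lp ℂ 2 (volume : Measure S.L) from f)).comp_measurePreserving
      (measurePreserving_sub_right (volume : Measure S.L) (S.L.orthogonalProjectionOnto v))
    refine MemLp.of_le h1 ?_ (Filter.Eventually.of_forall fun q => ?_)
    · refine AEStronglyMeasurable.mul (Continuous.aestronglyMeasurable ?_) h1.1
      fun_prop
    · rw [norm_mul, Complex.norm_exp_ofReal_mul_I, one_mul]
      rfl)

end SymplecticModel

/-- The metaplectic group: a connected topological group `G` with a homomorphism
`λ : G → Sp(V, ω₀)` that is a two-sheeted covering. -/
structure MetaplecticGroup (S : SymplecticModel n V) (G : Type*) [Group G] [TopologicalSpace G]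
    [IsTopologicalGroup G] where
  cov : G →* S.Sp
  isCoveringMap : IsCoveringMap cov
  two_sheeted : ∀ A : S.Sp, (cov ⁻¹' {A}).ncard = 2
  connected : ConnectedSpace G

variable {G : Type*} [Group G] [TopologicalSpace G] [IsTopologicalGroup G]

/-- The preimage of the unitary group in the metaplectic group. -/
def MetaplecticGroup.K {S : SymplecticModel n V} (Mp : MetaplecticGroup S G) : Subgroup G :=
  S.U.comap Mp.cov

/-- A Segal-Shale-Weil representation: a unitary representation of the metaplectic group on
`L²(L)`, continuous in the sense of representation theory, which intertwines a Schrödinger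
representation with its twists by symplectic maps. -/
structure SegalShaleWeil [FiniteDimensional ℝ V] [MeasurableSpace V] [BorelSpace V]
    (S : SymplecticModel n V) (Mp : MetaplecticGroup S G) where
  toHom : G →* (S.Hilb ≃ₗᵢ[ℂ] S.Hilb)
  continuous_action : Continuous fun x : G × S.Hilb => toHom x.1 x.2
  intertwines : ∃ t : ℝ, t ≠ 0 ∧ ∀ (g : G) (v : V) (f : S.Hilb),
    toHom g (S.weyl t v f) = S.weyl t (S.toEquiv (Mp.cov g) v) (toHom g f)

end Model

section Manifold

/-! ### Symplectic manifolds and metaplectic structures -/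

/-- The Euclidean space on which manifolds of dimension `2n` are modelled. -/
abbrev EE (n : ℕ) : Type := EuclideanSpace ℝ (Fin (2 * n))

/-- The tangent space of a manifold of dimension `2n`. -/
abbrev TT (n : ℕ) {M : Type*} [TopologicalSpace M] [ChartedSpace (EE n) M] (m : M) : Type :=
  TangentSpace 𝓘(ℝ, EE n) m

variable (n : ℕ) (M : Type*) [TopologicalSpace M] [ChartedSpace (EE n) M]
  [IsManifold 𝓘(ℝ, EE n) ∞ M]

instance (m : M) : Module.Finite ℝ (TT n m) := inferInstanceAs (Module.Finite ℝ (EE n))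

/-- A symplectic form: a smooth, closed and non-degenerate differential form of degree two. -/
structure SymplecticForm where
  toFun : ∀ m : M, TT n m →L[ℝ] TT n m →L[ℝ] ℝ
  smooth : ContMDiff 𝓘(ℝ, EE n) (𝓘(ℝ, EE n).prod 𝓘(ℝ, EE n →L[ℝ] EE n →L[ℝ] ℝ)) ∞
    (fun m => Bundle.TotalSpace.mk' (EE n →L[ℝ] EE n →L[ℝ] ℝ)
      (E := fun m : M => TT n m →L[ℝ] TT n m →L[ℝ] ℝ) m (toFun m))
  self_eq_zero : ∀ (m : M) (u : TT n m), toFun m u u = 0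
  nondegenerate : ∀ (m : M) (u : TT n m), (∀ v, toFun m u v = 0) → u = 0
  /-- `∂_u ω(v, w) + ∂_v ω(w, u) + ∂_w ω(u, v) = 0` in every chart, for constant `u`, `v`, `w`. -/
  closed : ∀ m₀ : M,
    let e := extChartAt 𝓘(ℝ, EE n) m₀
    let Φ : EE n → EE n → EE n → ℝ := fun x u v => toFun (e.symm x)
      (mfderiv 𝓘(ℝ, EE n) 𝓘(ℝ, EE n) e.symm x u) (mfderiv 𝓘(ℝ, EE n) 𝓘(ℝ, EE n) e.symm x v)
    ∀ x ∈ e.target, ∀ u v w : EE n,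
      fderiv ℝ (fun y => Φ y v w) x u + fderiv ℝ (fun y => Φ y w u) x v +
        fderiv ℝ (fun y => Φ y u v) x w = 0

variable {n M}

/-- A compatible positive almost complex structure: a smooth field of complex structures on the
tangent spaces such that `g(u, v) = ω(J u, v)` is a Riemannian metric. -/
structure CompatibleACS (Ω : SymplecticForm n M) where
  toFun : ∀ m : M, TT n m →L[ℝ] TT n m
  smooth : ContMDiff 𝓘(ℝ, EE n) (𝓘(ℝ, EE n).prod 𝓘(ℝ, EE n →L[ℝ] EE n)) ∞
    (fun m => Bundle.TotalSpace.mk' (EE n →L[ℝ] EE n)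
      (E := fun m : M => TT n m →L[ℝ] TT n m) m (toFun m))
  apply_apply : ∀ (m : M) (u : TT n m), toFun m (toFun m u) = -u
  symm : ∀ (m : M) (u v : TT n m), Ω.toFun m (toFun m u) v = Ω.toFun m (toFun m v) u
  pos : ∀ (m : M) (u : TT n m), u ≠ 0 → 0 < Ω.toFun m (toFun m u) u

/-- The Riemannian metric `g(u, v) = ω(J u, v)`. -/
def CompatibleACS.metric {Ω : SymplecticForm n M} (𝒥 : CompatibleACS Ω) (m : M) :
    TT n m →L[ℝ] TT n m →L[ℝ] ℝ :=
  (Ω.toFun m).comp (𝒥.toFun m)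

variable {V : Type*} [NormedAddCommGroup V] [InnerProductSpace ℝ V]

/-- The bundle of symplectic frames `A : V → T_m M`. -/
structure SympFrame (S : SymplecticModel n V) (Ω : SymplecticForm n M) where
  base : M
  frame : V ≃L[ℝ] TT n base
  symp : ∀ u v, Ω.toFun base (frame u) (frame v) = S.form u v

namespace SympFrame

variable {S : SymplecticModel n V} {Ω : SymplecticForm n M}

/-- A symplectic frame as a point of the bundle of linear maps from `V` to the tangent spaces. -/
def toHom (A : SympFrame S Ω) : Bundle.TotalSpace (V →L[ℝ] EE n)
    (fun m : M => Bundle.Trivial M V m →L[ℝ] TT n m) :=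
  ⟨A.base, (A.frame : V →L[ℝ] TT n A.base)⟩

/-- The topology on the bundle of frames is induced by that of the bundle of linear maps. -/
instance : TopologicalSpace (SympFrame S Ω) := TopologicalSpace.induced toHom inferInstance

/-- The right action `A ↦ A ∘ g` of the symplectic group. -/
def action (A : SympFrame S Ω) (g : S.Sp) : SympFrame S Ω where
  base := A.base
  frame := (S.toEquiv g).trans A.frame
  symp u v := (A.symp _ _).trans (g.2 u v)

/-- A frame is unitary if it intertwines the complex structures. -/
def IsUnitary (A : SympFrame S Ω) (𝒥 : CompatibleACS Ω) : Prop :=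
  ∀ u, A.frame (S.J u) = 𝒥.toFun A.base (A.frame u)

theorem isUnitary_action (A : SympFrame S Ω) (𝒥 : CompatibleACS Ω) (hA : A.IsUnitary 𝒥)
    (g : S.Sp) : (A.action g).IsUnitary 𝒥 ↔ g ∈ S.U := by
  rw [S.mem_U_iff]
  constructor
  · intro h u
    have h1 : A.frame (S.toEquiv g (S.J u)) = 𝒥.toFun A.base (A.frame (S.toEquiv g u)) := h u
    rw [← hA] at h1
    exact A.frame.injective h1
  · intro h u
    change A.frame (S.toEquiv g (S.J u)) = 𝒥.toFun A.base (A.frame (S.toEquiv g u))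
    rw [h, hA]

end SympFrame

variable {G : Type*} [Group G] [TopologicalSpace G] [IsTopologicalGroup G]

/-- A metaplectic structure: a principal bundle `P` over `M` for the metaplectic group, with a
continuous map `Λ` over `M` to the bundle of symplectic frames that is equivariant with respect to
the covering homomorphism. The bundle projection of `P` is that of the frame `Λ p`. -/
structure MetaplecticStructure {S : SymplecticModel n V} (Mp : MetaplecticGroup S G)
    (Ω : SymplecticForm n M) (P : Type*) [TopologicalSpace P] [MulAction Gᵐᵒᵖ P] where
  Λ : P → SympFrame S Ω
  continuous_Λ : Continuous Λ
  isPrincipalBundle : IsPrincipalBundle G fun p => (Λ p).base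
  Λ_action : ∀ (p : P) (g : G), Λ (MulOpposite.op g • p) = (Λ p).action (Mp.cov g)

end Manifold

section Bundles

/-! ### The oscillator bundles, Kuiper maps, and the bundle of measurements -/

variable {n : ℕ} {V : Type*} [NormedAddCommGroup V] [InnerProductSpace ℝ V]
  [FiniteDimensional ℝ V] [MeasurableSpace V] [BorelSpace V] {S : SymplecticModel n V}
  {G : Type*} [Group G] [TopologicalSpace G] [IsTopologicalGroup G] {Mp : MetaplecticGroup S G}

/-- `H`, the continuous dual of `L²(L)`. -/
abbrev SymplecticModel.H (S : SymplecticModel n V) : Type _ := HDual S.Hilb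

/-- `H^• = ⨁_{k = 0}^{2n} ⋀^k V* ⊗ H`. -/
abbrev SymplecticModel.HBullet (S : SymplecticModel n V) : Type _ := Forms (2 * n) V S.H

namespace SegalShaleWeil

variable (σ : SegalShaleWeil S Mp)

/-- The oscillator representation on `H`, the dual of the Segal-Shale-Weil representation. -/
def osc : G →* (S.H ≃ₗ[ℂ] S.H) where
  toFun g := (dualUnitary (σ.toHom g)).toLinearEquiv
  map_one' := by rw [map_one]; rfl
  map_mul' g g' := by rw [map_mul]; rfl

/-- The higher oscillator representation `σ^•(g) (α ⊗ u) = α ∘ λ(g)⁻¹ ⊗ σ(g) u` on `H^•`. -/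
def oscBullet : G →* (S.HBullet ≃ₗ[ℂ] S.HBullet) where
  toFun g :=
    { toFun := Forms.map ((S.toEquiv (Mp.cov g)).symm : V →L[ℝ] V)
        (dualUnitary (σ.toHom g) : S.H →L[ℂ] S.H)
      invFun := Forms.map (S.toEquiv (Mp.cov g) : V →L[ℝ] V)
        ((dualUnitary (σ.toHom g)).symm : S.H →L[ℂ] S.H)
      map_add' := Forms.map_add _ _
      map_smul' := Forms.map_smul _ _
      left_inv := fun f => by
        rw [Forms.map_map]
        refine Eq.trans ?_ (Forms.map_id f)
        congr 1
        · ext v; simp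
        · ext1 v; simp
      right_inv := fun f => by
        rw [Forms.map_map]
        refine Eq.trans ?_ (Forms.map_id f)
        congr 1
        · ext v; simp
        · ext1 v; simp }
  map_one' := by
    refine LinearEquiv.ext fun f => Eq.trans ?_ (Forms.map_id f)
    change Forms.map ((S.toEquiv (Mp.cov 1)).symm : V →L[ℝ] V)
      (dualUnitary (σ.toHom 1) : S.H →L[ℂ] S.H) f = _
    rw [map_one, map_one]
    rfl
  map_mul' g g' := by
    refine LinearEquiv.ext fun f => ?_
    refine Eq.trans ?_ (Forms.map_map _ _ _ _ f).symm
    change Forms.map ((S.toEquiv (Mp.cov (g * g'))).symm : V →L[ℝ] V)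
      (dualUnitary (σ.toHom (g * g')) : S.H →L[ℂ] S.H) f = _
    congr 1
    · rw [map_mul]
      ext v
      change ((Mp.cov g * Mp.cov g' : S.Sp)⁻¹).1.1 v = _
      rw [mul_inv_rev]
      rfl
    · rw [map_mul]
      rfl

theorem oscBullet_apply (g : G) (f : S.HBullet) :
    σ.oscBullet g f = Forms.map ((S.toEquiv (Mp.cov g)).symm : V →L[ℝ] V)
      (dualUnitary (σ.toHom g) : S.H →L[ℂ] S.H) f := rfl

/-- The representation `ρ(g) a = σ̌(g) ∘ a ∘ σ̌(g)⁻¹` on the compact operators. -/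
def onCH : G →* (CH S.Hilb ≃ₗ[ℂ] CH S.Hilb) where
  toFun g := CH.conj (σ.toHom g)
  map_one' := by rw [map_one]; rfl
  map_mul' g g' := by rw [map_mul]; rfl

theorem oscBullet_act (g : G) (f : S.HBullet) (a : CH S.Hilb) :
    (σ.oscBullet g f).act (σ.onCH g a) = σ.oscBullet g (f.act a) :=
  Forms.map_act _ _ _ _

theorem oscBullet_prod (g : Mp.K) (f h : S.HBullet) :
    Forms.prod (innerSL ℝ) (σ.oscBullet g f) (σ.oscBullet g h) =
      σ.onCH g (Forms.prod (innerSL ℝ) f h) := by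
  have hg : ∀ u v, inner ℝ (S.toEquiv (Mp.cov g) u) (S.toEquiv (Mp.cov g) v) = inner ℝ u v := g.2
  refine Forms.prod_map (innerSL ℝ) (S.toEquiv (Mp.cov g)).symm (fun u v => ?_) _ f h
  change inner ℝ _ _ = inner ℝ u v
  rw [← hg]
  simp

end SegalShaleWeil

variable {M : Type*} [TopologicalSpace M] [ChartedSpace (EE n) M] [IsManifold 𝓘(ℝ, EE n) ∞ M]
  {Ω : SymplecticForm n M} {P : Type*} [TopologicalSpace P] [MulAction Gᵐᵒᵖ P]

/-- The basic oscillator bundle `𝓗 = P ×_σ H`. -/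
abbrev OscillatorBundle (P : Type*) [MulAction Gᵐᵒᵖ P] (σ : SegalShaleWeil S Mp) : Type _ :=
  Assoc P σ.osc

namespace MetaplecticStructure

/-- The bundle projection `P → M`. -/
def pr (Λ : MetaplecticStructure Mp Ω P) (p : P) : M := (Λ.Λ p).base

/-- The frame `V → T_m M` given by an element of `P`. -/
def frame (Λ : MetaplecticStructure Mp Ω P) (p : P) : V ≃L[ℝ] TT n (Λ.pr p) := (Λ.Λ p).frame

theorem simplyTransitive (Λ : MetaplecticStructure Mp Ω P) : SimplyTransitive G Λ.pr :=
  Λ.isPrincipalBundle.simplyTransitive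

/-- The reduction `P_R` of `P`: the preimage of the bundle of unitary frames. -/
def Reduction (Λ : MetaplecticStructure Mp Ω P) (𝒥 : CompatibleACS Ω) : Type _ :=
  {p : P // (Λ.Λ p).IsUnitary 𝒥}

variable {Λ : MetaplecticStructure Mp Ω P} {𝒥 : CompatibleACS Ω}

instance : TopologicalSpace (Λ.Reduction 𝒥) :=
  inferInstanceAs (TopologicalSpace {p : P // (Λ.Λ p).IsUnitary 𝒥})

theorem isUnitary_smul (p : P) (hp : (Λ.Λ p).IsUnitary 𝒥) (g : G) :
    (Λ.Λ (MulOpposite.op g • p)).IsUnitary 𝒥 ↔ g ∈ Mp.K := by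
  rw [Λ.Λ_action]
  exact SympFrame.isUnitary_action _ 𝒥 hp _

instance : MulAction (Mp.K)ᵐᵒᵖ (Λ.Reduction 𝒥) where
  smul g q := ⟨MulOpposite.op (g.unop : G) • q.1, (isUnitary_smul q.1 q.2 _).2 g.unop.2⟩
  one_smul q := Subtype.ext (one_smul Gᵐᵒᵖ q.1)
  mul_smul g h q := Subtype.ext
    (mul_smul (MulOpposite.op (g.unop : G)) (MulOpposite.op (h.unop : G)) q.1)

/-- The inclusion `P_R → P`. -/
def Reduction.toP (q : Λ.Reduction 𝒥) : P := Subtype.val (p := fun p => (Λ.Λ p).IsUnitary 𝒥) q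

theorem Reduction.toP_smul (q : Λ.Reduction 𝒥) (g : Mp.K) :
    (MulOpposite.op g • q).toP = MulOpposite.op (g : G) • q.toP := rfl

/-- The bundle projection `P_R → M`. -/
def redPr (Λ : MetaplecticStructure Mp Ω P) (𝒥 : CompatibleACS Ω) (q : Λ.Reduction 𝒥) : M :=
  Λ.pr q.toP

theorem redPr_simplyTransitive (Λ : MetaplecticStructure Mp Ω P) (𝒥 : CompatibleACS Ω) :
    SimplyTransitive Mp.K (Λ.redPr 𝒥) where
  proj_action q g := Λ.simplyTransitive.proj_action q.toP g
  existsUnique q r h := by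
    obtain ⟨g, hg, hu⟩ := Λ.simplyTransitive.existsUnique q.toP r.toP h
    have hgK : g ∈ Mp.K := by
      rw [← isUnitary_smul (𝒥 := 𝒥) q.toP q.2 g, ← hg]
      exact r.2
    exact ⟨⟨g, hgK⟩, Subtype.ext hg, fun k hk => Subtype.ext (hu k (congrArg Subtype.val hk))⟩

end MetaplecticStructure

/-- The reduced higher oscillator bundle `𝓗^•_R = P_R ×_{σ^•} H^•`. -/
abbrev ReducedBundle (σ : SegalShaleWeil S Mp) (Λ : MetaplecticStructure Mp Ω P)
    (𝒥 : CompatibleACS Ω) : Type _ :=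
  Assoc (Λ.Reduction 𝒥) (σ.oscBullet.comp Mp.K.subtype)

/-- The reduced bundle of measurements `𝓒𝓗_R = P_R ×_ρ CH`. -/
abbrev MeasurementBundle (σ : SegalShaleWeil S Mp) (Λ : MetaplecticStructure Mp Ω P)
    (𝒥 : CompatibleACS Ω) : Type _ :=
  Assoc (Λ.Reduction 𝒥) (σ.onCH.comp Mp.K.subtype)

/-- A (normalized) Kuiper map: a homeomorphism `𝓗 → M × H` over `M` that is unitary on each
fibre. -/
structure KuiperMap (σ : SegalShaleWeil S Mp) (Λ : MetaplecticStructure Mp Ω P) where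
  toHomeomorph : OscillatorBundle P σ ≃ₜ M × S.H
  fst_eq : ∀ y, (toHomeomorph y).1 = Assoc.proj Λ.simplyTransitive y
  map_add : ∀ (p : P) (u v : S.H), (toHomeomorph (Assoc.mk σ.osc p (u + v))).2 =
    (toHomeomorph (Assoc.mk σ.osc p u)).2 + (toHomeomorph (Assoc.mk σ.osc p v)).2
  map_smul : ∀ (p : P) (c : ℂ) (u : S.H), (toHomeomorph (Assoc.mk σ.osc p (c • u))).2 =
    c • (toHomeomorph (Assoc.mk σ.osc p u)).2
  norm_map : ∀ (p : P) (u : S.H), ‖(toHomeomorph (Assoc.mk σ.osc p u)).2‖ = ‖u‖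

variable {σ : SegalShaleWeil S Mp} {Λ : MetaplecticStructure Mp Ω P} {𝒥 : CompatibleACS Ω}

namespace KuiperMap

variable (J : KuiperMap σ Λ)

/-- The unitary operator `u ↦ pr₂ J[(p, u)]` of `H`. -/
def fib (p : P) : S.H ≃ₗᵢ[ℂ] S.H :=
  LinearIsometryEquiv.ofSurjective
    { toFun := fun u => (J.toHomeomorph (Assoc.mk σ.osc p u)).2
      map_add' := J.map_add p
      map_smul' := J.map_smul p
      norm_map' := J.norm_map p } (by
    intro w
    obtain ⟨y, hy⟩ := J.toHomeomorph.surjective (Λ.pr p, w)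
    obtain ⟨u, rfl⟩ := Assoc.exists_rep Λ.simplyTransitive y p (by rw [← J.fst_eq, hy])
    exact ⟨u, congrArg Prod.snd hy⟩)

theorem fib_apply (p : P) (u : S.H) : J.fib p u = (J.toHomeomorph (Assoc.mk σ.osc p u)).2 := rfl

theorem fib_action (p : P) (g : G) :
    J.fib p * dualUnitary (σ.toHom g) = J.fib (MulOpposite.op g • p) := by
  refine LinearIsometryEquiv.ext fun u => ?_
  rw [fib_apply, Assoc.mk_action]
  rfl

/-- The unitary operator `v ↦ pr₂ J̌[(p, v)]` of `L²(L)`, where `J̌[(p, v)] = (J[(p, v^♭)])^♯`. -/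
def fibCheck (p : P) : S.Hilb ≃ₗᵢ[ℂ] S.Hilb := sharpConj (J.fib p)

theorem fibCheck_action (p : P) (g : G) :
    J.fibCheck p * σ.toHom g = J.fibCheck (MulOpposite.op g • p) := by
  unfold fibCheck
  rw [← fib_action, sharpConj_mul, sharpConj_dualUnitary]

/-- The trivialization `J_CH : 𝓒𝓗_R → M × CH` of the bundle of measurements,
`[(q, a)] ↦ (m, J̌_q ∘ a ∘ J̌_q⁻¹)`. -/
def onCH (𝒥 : CompatibleACS Ω) (y : MeasurementBundle σ Λ 𝒥) : M × CH S.Hilb :=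
  Assoc.lift (fun q a => (Λ.redPr 𝒥 q, CH.conj (J.fibCheck q.toP) a)) (fun q g a => by
    refine Prod.ext ((Λ.redPr_simplyTransitive 𝒥).proj_action q g) ?_
    change CH.conj (J.fibCheck (MulOpposite.op g • q).toP) a =
      CH.conj (J.fibCheck q.toP) (CH.conj (σ.toHom g) a)
    rw [MetaplecticStructure.Reduction.toP_smul, ← fibCheck_action, conj_mul]
    rfl) y

theorem onCH_mk (q : Λ.Reduction 𝒥) (a : CH S.Hilb) :
    J.onCH 𝒥 (Assoc.mk _ q a) = (Λ.redPr 𝒥 q, CH.conj (J.fibCheck q.toP) a) := rfl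

theorem onCH_fst (y : MeasurementBundle σ Λ 𝒥) :
    (J.onCH 𝒥 y).1 = Assoc.proj (Λ.redPr_simplyTransitive 𝒥) y :=
  Assoc.ind (C := fun y => (J.onCH 𝒥 y).1 = Assoc.proj (Λ.redPr_simplyTransitive 𝒥) y)
    (fun _ _ => rfl) y

/-- On rank one operators, `J_CH [(q, v ⊗ f)] = (m, pr₂ J̌[(q, v)] ⊗ pr₂ J[(q, f)])`. -/
theorem onCH_tens (q : Λ.Reduction 𝒥) (v : S.Hilb) (f : S.H) :
    J.onCH 𝒥 (Assoc.mk _ q (tens v f)) =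
      (Λ.redPr 𝒥 q, tens (J.fibCheck q.toP v) (J.toHomeomorph (Assoc.mk σ.osc q.toP f)).2) := by
  refine Prod.ext rfl ?_
  change CH.conj (J.fibCheck q.toP) (tens v f) = _
  rw [conj_tens, fibCheck, dualUnitary_sharpConj]
  rfl

theorem existsUnique_onCH (q : Λ.Reduction 𝒥) (a : CH S.Hilb) :
    ∃! y : MeasurementBundle σ Λ 𝒥, J.onCH 𝒥 y = (Λ.redPr 𝒥 q, a) := by
  refine ⟨Assoc.mk _ q ((CH.conj (J.fibCheck q.toP)).symm a),
    Prod.ext rfl ((CH.conj (J.fibCheck q.toP)).apply_symm_apply a), ?_⟩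
  intro y hy
  have hb : Λ.redPr 𝒥 q = Assoc.proj (Λ.redPr_simplyTransitive 𝒥) y := by
    rw [← J.onCH_fst, hy]
  obtain ⟨b, rfl⟩ := Assoc.exists_rep _ y q hb
  congr 1
  rw [LinearEquiv.eq_symm_apply]
  exact congrArg Prod.snd hy

end KuiperMap

/-! ### The structure of a Hilbert `CH`-bundle on the reduced higher oscillator bundle -/

namespace ReducedBundle

/-- The bundle projection. -/
def proj (y : ReducedBundle σ Λ 𝒥) : M := Assoc.proj (Λ.redPr_simplyTransitive 𝒥) y

/-- The class `[(q, f)]`. -/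
def mk (σ : SegalShaleWeil S Mp) (q : Λ.Reduction 𝒥) (f : S.HBullet) : ReducedBundle σ Λ 𝒥 :=
  Assoc.mk _ q f

/-- The element `α ⊗ h` of the fibre over `m = π(q)`, where `α` is a `k`-form on `T_m M` and
`h = [(q, u)]`: the class of `(q, (Λ(q)^* α) ⊗ u)`. -/
def tmul (σ : SegalShaleWeil S Mp) (q : Λ.Reduction 𝒥) {k : Fin (2 * n + 1)}
    (α : TT n (Λ.pr q.toP) [⋀^Fin k]→L[ℝ] ℝ) (u : S.H) : ReducedBundle σ Λ 𝒥 :=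
  mk σ q (Forms.tmul (α.compContinuousLinearMap (Λ.frame q.toP : V →L[ℝ] TT n (Λ.pr q.toP))) u)

/-- The fibrewise addition `([(q, f)], [(q, h)]) ↦ [(q, f + h)]`. -/
def add (x y : ReducedBundle σ Λ 𝒥) (h : proj x = proj y) : ReducedBundle σ Λ 𝒥 :=
  Assoc.map₂ (Λ.redPr_simplyTransitive 𝒥) _ (fun f f' => f + f') x y h

theorem add_mk (q : Λ.Reduction 𝒥) (f f' : S.HBullet) :
    add (mk σ q f) (mk σ q f') rfl = mk σ q (f + f') :=
  Assoc.map₂_mk (Λ.redPr_simplyTransitive 𝒥) _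
    (fun g x y => (map_add (σ.oscBullet (g : G)) x y).symm) q f f' rfl

/-- The fibrewise multiplication by scalars `[(q, f)] ↦ [(q, c f)]`. -/
def smul (c : ℂ) (x : ReducedBundle σ Λ 𝒥) : ReducedBundle σ Λ 𝒥 :=
  Assoc.lift (fun q f => mk σ q (c • f)) (fun q g f => by
    unfold mk
    rw [Assoc.mk_action, LinearEquiv.map_smul]) x

theorem smul_mk (c : ℂ) (q : Λ.Reduction 𝒥) (f : S.HBullet) :
    smul c (mk σ q f) = mk σ q (c • f) := rfl

/-- The action of the bundle of measurements, `[(q, f)] · [(q, a)] = [(q, f · a)]`. -/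
def actBundle (x : ReducedBundle σ Λ 𝒥) (b : MeasurementBundle σ Λ 𝒥)
    (h : proj x = Assoc.proj (Λ.redPr_simplyTransitive 𝒥) b) : ReducedBundle σ Λ 𝒥 :=
  Assoc.map₂ (Λ.redPr_simplyTransitive 𝒥) _ Forms.act x b h

theorem actBundle_mk (q : Λ.Reduction 𝒥) (f : S.HBullet) (a : CH S.Hilb) :
    actBundle (mk σ q f) (Assoc.mk _ q a) rfl = mk σ q (f.act a) :=
  Assoc.map₂_mk (Λ.redPr_simplyTransitive 𝒥) _ (fun g x y => σ.oscBullet_act (g : G) x y) q f a rfl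

/-- The product with values in the bundle of measurements,
`([(q, f)], [(q, h)]) ↦ [(q, (f, h))]`. -/
def prodBundle (x y : ReducedBundle σ Λ 𝒥) (h : proj x = proj y) : MeasurementBundle σ Λ 𝒥 :=
  Assoc.map₂ (Λ.redPr_simplyTransitive 𝒥) _ (Forms.prod (innerSL ℝ)) x y h

theorem prodBundle_mk (q : Λ.Reduction 𝒥) (f h : S.HBullet) :
    prodBundle (mk σ q f) (mk σ q h) rfl = Assoc.mk _ q (Forms.prod (innerSL ℝ) f h) :=
  Assoc.map₂_mk _ _ (fun g x y => σ.oscBullet_prod g x y) q f h rfl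

theorem existsUnique_onCH (J : KuiperMap σ Λ) (x : ReducedBundle σ Λ 𝒥) (a : CH S.Hilb) :
    ∃! y : MeasurementBundle σ Λ 𝒥, J.onCH 𝒥 y = (proj x, a) := by
  induction x using Assoc.ind with
  | h q f => exact J.existsUnique_onCH q a

/-- `J_CH⁻¹(m, a)`, where `m` is the base point of `x`. -/
def invOnCH (J : KuiperMap σ Λ) (x : ReducedBundle σ Λ 𝒥) (a : CH S.Hilb) :
    MeasurementBundle σ Λ 𝒥 :=
  (existsUnique_onCH J x a).choose

theorem onCH_invOnCH (J : KuiperMap σ Λ) (x : ReducedBundle σ Λ 𝒥) (a : CH S.Hilb) :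
    J.onCH 𝒥 (invOnCH J x a) = (proj x, a) :=
  (existsUnique_onCH J x a).choose_spec.1

theorem proj_invOnCH (J : KuiperMap σ Λ) (x : ReducedBundle σ Λ 𝒥) (a : CH S.Hilb) :
    proj x = Assoc.proj (Λ.redPr_simplyTransitive 𝒥) (invOnCH J x a) := by
  rw [← J.onCH_fst, onCH_invOnCH]

/-- The right action of `CH`, `x · a = x · J_CH⁻¹(m, a)`. -/
def act (J : KuiperMap σ Λ) (x : ReducedBundle σ Λ 𝒥) (a : CH S.Hilb) : ReducedBundle σ Λ 𝒥 :=
  actBundle x (invOnCH J x a) (proj_invOnCH J x a)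

/-- The `CH`-valued product, `(x, y) = pr₂ J_CH (x, y)_𝓒𝓗`. -/
def prod (J : KuiperMap σ Λ) (x y : ReducedBundle σ Λ 𝒥) (h : proj x = proj y) : CH S.Hilb :=
  (J.onCH 𝒥 (prodBundle x y h)).2

end ReducedBundle

/-! ### The bundle `⋀^• T*M ⊗ (M × H)` -/

/-- The total space of the bundle `⨁_{k = 0}^{2n} ⋀^k T*M ⊗ (M × X)`, where `M × X` is the trivial
bundle with fibre `X`. -/
@[ext]
structure FormBundle (n : ℕ) (M X : Type*) [TopologicalSpace M] [ChartedSpace (EE n) M]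
    [NormedAddCommGroup X] [NormedSpace ℂ X] where
  base : M
  form : Forms (2 * n) (TT n base) X

namespace FormBundle

section Topology

variable {X : Type*} [NormedAddCommGroup X] [NormedSpace ℂ X]

/-- The homogeneous component of degree `k`. -/
def component (k : Fin (2 * n + 1)) (y : FormBundle n M X) :
    Bundle.TotalSpace (EE n [⋀^Fin k]→L[ℝ] X)
      (fun m : M => TT n m [⋀^Fin k]→L[ℝ] Bundle.Trivial M X m) :=
  ⟨y.base, y.form k⟩

/-- The topology of the direct sum of the vector bundles `⋀^k T*M ⊗ (M × X)`. -/
instance : TopologicalSpace (FormBundle n M X) :=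
  TopologicalSpace.induced (fun y k => component k y) inferInstance

/-- The fibrewise addition. -/
def add (x y : FormBundle n M X) (h : x.base = y.base) : FormBundle n M X :=
  ⟨y.base, (h ▸ x.form) + y.form⟩

/-- The fibrewise multiplication by scalars. -/
def smul (c : ℂ) (x : FormBundle n M X) : FormBundle n M X := ⟨x.base, c • x.form⟩

theorem add_mk (m : M) (f f' : Forms (2 * n) (TT n m) X) :
    add ⟨m, f⟩ ⟨m, f'⟩ rfl = ⟨m, f + f'⟩ := rfl

/-- The element `α ⊗ (m, u)`, for a `k`-form `α` on `T_m M`. -/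
def tmul {m : M} {k : Fin (2 * n + 1)} (α : TT n m [⋀^Fin k]→L[ℝ] ℝ) (u : X) :
    FormBundle n M X := ⟨m, Forms.tmul α u⟩

end Topology

variable {E : Type*} [NormedAddCommGroup E] [InnerProductSpace ℂ E] [CompleteSpace E]

/-- The right action of `CH`, `(α ⊗ (m, u)) · a = α ⊗ (m, u ∘ a)`. -/
def act (x : FormBundle n M (HDual E)) (a : CH E) : FormBundle n M (HDual E) :=
  ⟨x.base, x.form.act a⟩

/-- The `CH`-valued product, `(α ⊗ (m, u), β ⊗ (m, v)) = g(α, β) u^♯ ⊗ v`. -/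
def prod (𝒥 : CompatibleACS Ω) (x y : FormBundle n M (HDual E)) (h : x.base = y.base) : CH E :=
  Forms.prod (𝒥.metric y.base) (h ▸ x.form) y.form

theorem prod_mk (𝒥 : CompatibleACS Ω) (m : M) (f f' : Forms (2 * n) (TT n m) (HDual E)) :
    prod 𝒥 ⟨m, f⟩ ⟨m, f'⟩ rfl = Forms.prod (𝒥.metric m) f f' := rfl

end FormBundle

/-! ### Charts and isomorphisms -/

/-- A smooth frame `V → T_m M` of the tangent bundle over an open subset of `M`. -/
structure LocalFrame (n : ℕ) (V M : Type*) [NormedAddCommGroup V] [InnerProductSpace ℝ V]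
    [TopologicalSpace M] [ChartedSpace (EE n) M] [IsManifold 𝓘(ℝ, EE n) ∞ M] where
  domain : Set M
  isOpen_domain : IsOpen domain
  toFun : ∀ m : M, V ≃L[ℝ] TT n m
  smooth : ∀ v : V, ContMDiffOn 𝓘(ℝ, EE n) (𝓘(ℝ, EE n).prod 𝓘(ℝ, EE n)) ∞
    (fun m => Bundle.TotalSpace.mk' (EE n) (E := fun m : M => TT n m) m (toFun m v)) domain

/-- The automorphism `Λ⁻¹ ∘ F_m` of `V`, for a symplectic frame `Λ` at `m`. -/
def LocalFrame.compare (F : LocalFrame n V M) (A : SympFrame S Ω) : V ≃L[ℝ] V :=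
  (F.toFun A.base).trans A.frame.symm

theorem LocalFrame.compare_action (F : LocalFrame n V M) (A : SympFrame S Ω) (g : S.Sp) :
    F.compare (A.action g) = (F.compare A).trans (S.toEquiv g).symm := rfl

/-- The chart of `𝓗^•_R` that is the tensor product of the chart of `⋀^• T*M` given by a frame `F`
and of the chart `μ J` of `𝓗_R` with `μ ∈ ℂˣ`. It maps the element `α ⊗ h` of the fibre over `m` to
`(F_m^* α) ⊗ μ (pr₂ J h)`. -/
def ReducedBundle.chart (J : KuiperMap σ Λ) (F : LocalFrame n V M) (μ : ℂˣ)
    (y : ReducedBundle σ Λ 𝒥) : S.HBullet :=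
  Assoc.lift (fun q f => (μ : ℂ) •
    Forms.map (F.compare (Λ.Λ q.toP) : V →L[ℝ] V) (J.fib q.toP : S.H →L[ℂ] S.H) f)
    (fun q g f => by
      rw [MetaplecticStructure.Reduction.toP_smul, Λ.Λ_action, ← J.fib_action, F.compare_action]
      rw [MonoidHom.comp_apply, Subgroup.coe_subtype, σ.oscBullet_apply, Forms.map_map]
      rfl) y

theorem ReducedBundle.chart_tmul (J : KuiperMap σ Λ) (F : LocalFrame n V M) (μ : ℂˣ)
    (q : Λ.Reduction 𝒥) {k : Fin (2 * n + 1)} (α : TT n (Λ.pr q.toP) [⋀^Fin k]→L[ℝ] ℝ) (u : S.H) :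
    chart J F μ (tmul σ q α u) = (μ : ℂ) • Forms.tmul
      (α.compContinuousLinearMap (F.toFun (Λ.pr q.toP) : V →L[ℝ] TT n (Λ.pr q.toP)))
      (J.toHomeomorph (Assoc.mk σ.osc q.toP u)).2 := by
  change (μ : ℂ) • Forms.map (F.compare (Λ.Λ q.toP) : V →L[ℝ] V) (J.fib q.toP : S.H →L[ℂ] S.H)
    (Forms.tmul (α.compContinuousLinearMap (Λ.frame q.toP : V →L[ℝ] TT n (Λ.pr q.toP))) u) = _
  rw [Forms.map_tmul]
  congr 2
  ext w
  change α _ = α _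
  congr 1
  funext i
  exact (Λ.Λ q.toP).frame.apply_symm_apply _

/-- The chart of `⋀^• T*M ⊗ (M × H)` that is the tensor product of the chart of `⋀^• T*M` given by
a frame `F` and of the chart `μ Id` of `M × H` with `μ ∈ ℂˣ`. It maps `α ⊗ (m, u)` to
`(F_m^* α) ⊗ μ u`. -/
def FormBundle.chart {X : Type*} [NormedAddCommGroup X] [NormedSpace ℂ X] (F : LocalFrame n V M)
    (μ : ℂˣ) (y : FormBundle n M X) : Forms (2 * n) V X :=
  (μ : ℂ) • Forms.map (F.toFun y.base : V →L[ℝ] TT n y.base) (ContinuousLinearMap.id ℂ X) y.form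

/-- A unitary isomorphism of the Hilbert `CH`-bundles `𝓗^•_R` and `⋀^• T*M ⊗ (M × H)`: a
homeomorphism of the total spaces over `M`, complex linear on the fibres, which intertwines the
actions of `CH` and the `CH`-valued products, and which is smooth with respect to the Hilbert
`C*`-bundle structures: in charts it is given by a smooth function with values in the
automorphisms of the Hilbert `CH`-module `H^•`. -/
structure IsUnitaryIso (J : KuiperMap σ Λ) (𝒥 : CompatibleACS Ω)
    (T : ReducedBundle σ Λ 𝒥 ≃ₜ FormBundle n M S.H) : Prop where
  base_eq : ∀ x, (T x).base = ReducedBundle.proj x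
  map_add : ∀ x y (h : ReducedBundle.proj x = ReducedBundle.proj y),
    T (ReducedBundle.add x y h) =
      FormBundle.add (T x) (T y) ((base_eq x).trans (h.trans (base_eq y).symm))
  map_smul : ∀ (c : ℂ) x, T (ReducedBundle.smul c x) = FormBundle.smul c (T x)
  map_act : ∀ x (a : CH S.Hilb), T (ReducedBundle.act J x a) = FormBundle.act (T x) a
  map_prod : ∀ x y (h : ReducedBundle.proj x = ReducedBundle.proj y),
    FormBundle.prod 𝒥 (T x) (T y) ((base_eq x).trans (h.trans (base_eq y).symm)) =
      ReducedBundle.prod J x y h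
  smooth : ∀ (F F' : LocalFrame n V M) (μ μ' : ℂˣ), ∃ τ : M → S.HBullet →L[ℂ] S.HBullet,
    ContMDiffOn 𝓘(ℝ, EE n) 𝓘(ℝ, S.HBullet →L[ℂ] S.HBullet) ∞ τ (F.domain ∩ F'.domain) ∧
    (∀ m ∈ F.domain ∩ F'.domain, IsUnit (τ m) ∧
      ∀ (f : S.HBullet) (a : CH S.Hilb), τ m (f.act a) = (τ m f).act a) ∧
    ∀ x : ReducedBundle σ Λ 𝒥, ReducedBundle.proj x ∈ F.domain ∩ F'.domain →
      FormBundle.chart F' μ' (T x) = τ (ReducedBundle.proj x) (ReducedBundle.chart J F μ x)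

end Bundles

end Metaplectic

end

open Metaplectic

/-! The isomorphism is forced. In a unitary frame `q` over `m`, the map `[(q, f)] ↦ (⋀(Λ(q)⁻¹)^* ⊗
J_q) f`, where `J_q` is the unitary operator of `H` given by the Kuiper map at `q`, is the only
candidate (`toFormBundle`). It does not depend on `q`: passing to `q·g` changes the frame by `λ(g)`
and `J_q` by `σ(g)`, which are exactly the two factors of `σ^•(g)`.

The algebraic identities are checked in one frame. The action and the product on `𝓗^•_R` are
transported through `J_CH`, that is, through conjugation by the unitary operator of `L²(L)` dual to
`J_q`. This conjugation cancels against `J_q` (`toFormBundle_act`). For the product one also needs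
that a unitary frame is an isometry from `(V, g₀)` to `(T_m M, g)`, and that the induced pairing of
forms is invariant under isometries between different spaces, because it can be computed in any
basis (`formPairing_eq_sum_basis`).

Continuity of the map descends from `P_R × H^•` to the quotient. For the inverse, local sections of
`P_R → M` are needed (`exists_local_section`). Start from a local section of `P` and read the almost
complex structure of `M` in its frame, as a compatible complex structure `K` on `V`. With `C = -(K +
J₀)²`, the symplectic map `(K + J₀) C^{-1/2}` takes `J₀` to `K` and depends continuously on `K`.
Lift it to the metaplectic group near the given point and correct the section by it. Strong
continuity of `J_q` passes to `J_q⁻¹` since the operators are isometric (`continuousAt_fib_symm`),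
so the formula for the inverse is continuous.

The Kuiper map is only continuous, but it does not threaten smoothness: the smooth structure of
`𝓗^•_R` is itself defined by charts containing `J`. In the two charts `J` therefore cancels, and
what is left is the pullback by a smooth change of tangent frames times a constant
(`chart_toFormBundle`). -/

noncomputable section

namespace Metaplectic

/-! ### Inverse square roots of positive definite operators -/

section InverseSquareRoot

variable {V : Type*} [NormedAddCommGroup V] [InnerProductSpace ℝ V]

/-- Symmetric positive definite operators of a real inner product space. -/
def IsSymmPosDef (C : V →L[ℝ] V) : Prop :=
  (∀ u v, inner ℝ (C u) v = inner ℝ u (C v)) ∧ ∀ u, u ≠ 0 → 0 < inner ℝ (C u) u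

open scoped MatrixOrder Matrix.Norms.L2Operator in
-- The L² operator norm makes matrices a C*-algebra, in which negative powers are continuous on
-- strictly positive elements.
theorem continuousOn_matrix_rpow {ι : Type*} [Fintype ι] [DecidableEq ι] :
    ContinuousOn (fun A : Matrix ι ι ℝ => A ^ (-(1 / 2) : ℝ)) {A | A.PosDef} := by
  have := CFC.continuousOn_rpow (A := Matrix ι ι ℝ) (-(1 / 2))
  refine this.mono fun A hA => ?_
  exact hA.isStrictlyPositive

open scoped MatrixOrder Matrix.Norms.L2Operator in
-- Exponents add on invertible positive elements, and `-1/2 - 1/2 + 1 = 0`.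
theorem matrix_rpow_mul {ι : Type*} [Fintype ι] [DecidableEq ι] {A : Matrix ι ι ℝ}
    (hA : A.PosDef) :
    A ^ (-(1 / 2) : ℝ) * A ^ (-(1 / 2) : ℝ) * A = 1 := by
  have h0 : IsStrictlyPositive A := hA.isStrictlyPositive
  conv_lhs => rhs; rw [← CFC.rpow_one A h0.nonneg]
  rw [← CFC.rpow_add h0.isUnit, ← CFC.rpow_add h0.isUnit]
  norm_num
  exact CFC.rpow_zero A h0.nonneg

open scoped MatrixOrder Matrix.Norms.L2Operator in
theorem matrix_rpow_isHermitian {ι : Type*} [Fintype ι] [DecidableEq ι] (A : Matrix ι ι ℝ) :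
    (A ^ (-(1 / 2) : ℝ)).IsHermitian :=
  (Matrix.nonneg_iff_posSemidef.1 (CFC.rpow_nonneg (a := A))).1

open scoped MatrixOrder Matrix.Norms.L2Operator in
theorem matrix_rpow_commute {ι : Type*} [Fintype ι] [DecidableEq ι] {A D : Matrix ι ι ℝ}
    (h : Commute A D) : Commute (A ^ (-(1 / 2) : ℝ)) D := by
  rw [CFC.rpow_def]
  exact h.cfc_nnreal _

variable [FiniteDimensional ℝ V]

open scoped MatrixOrder Matrix.Norms.L2Operator in
/-- The inverse square root of symmetric positive definite operators. -/
theorem exists_inverse_sqrt : ∃ R : (V →L[ℝ] V) → (V →L[ℝ] V),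
    ContinuousOn R {C | IsSymmPosDef C} ∧
    ∀ C, IsSymmPosDef C → (∀ u v, inner ℝ (R C u) v = inner ℝ u (R C v)) ∧
      R C * R C * C = 1 ∧ ∀ D, Commute C D → Commute (R C) D := by
  set b := stdOrthonormalBasis ℝ V
  -- Orthonormality of the basis is what turns symmetry and positivity for the inner product into
  -- the same notions for matrices. In finite dimension the algebra isomorphism is also a
  -- homeomorphism, so continuity transfers as well.
  let e : (V →L[ℝ] V) ≃ₐ[ℝ] Matrix (Fin (Module.finrank ℝ V)) (Fin (Module.finrank ℝ V)) ℝ :=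
    (AlgEquiv.ofLinearEquiv
      (LinearMap.toContinuousLinearMap : (V →ₗ[ℝ] V) ≃ₗ[ℝ] (V →L[ℝ] V))
      rfl (fun _ _ => rfl)).symm.trans
      (LinearMap.toMatrixOrthonormal b).toAlgEquiv
  have he : ∀ C i j, e C i j = inner ℝ (b i) (C (b j)) := fun C i j =>
    LinearMap.toMatrixOrthonormal_apply_apply b (C : V →ₗ[ℝ] V) i j
  have hc : Continuous e := LinearMap.continuous_of_finiteDimensional e.toLinearMap
  have hc' : Continuous e.symm := LinearMap.continuous_of_finiteDimensional e.symm.toLinearMap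
  have hinner : ∀ (C : V →L[ℝ] V) (u v : V), inner ℝ u (C v) =
      (b.repr u).ofLp ⬝ᵥ ((e C).mulVec (b.repr v).ofLp) := by
    intro C u v
    conv_lhs => rw [← b.sum_repr u, ← b.sum_repr v]
    simp [dotProduct, Matrix.mulVec, he, sum_inner, inner_sum, inner_smul_left, inner_smul_right,
      Finset.mul_sum, mul_comm, mul_left_comm]
    exact Finset.sum_comm
  have hsymm : ∀ C : V →L[ℝ] V, (∀ u v, inner ℝ (C u) v = inner ℝ u (C v)) ↔
      (e C).IsHermitian := by
    intro C
    constructor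
    · intro h
      ext i j
      rw [Matrix.conjTranspose_apply, he, he, ← h, real_inner_comm]
      rfl
    · intro h u v
      rw [real_inner_comm, hinner, hinner]
      rw [Matrix.dotProduct_mulVec, ← Matrix.mulVec_transpose, dotProduct_comm]
      congr 2
  have hpos : ∀ C : V →L[ℝ] V, IsSymmPosDef C → (e C).PosDef := by
    intro C hC
    refine Matrix.posDef_iff_dotProduct_mulVec.2 ⟨(hsymm C).1 hC.1, fun {x} hx => ?_⟩
    have h1 := hC.2 (b.repr.symm (WithLp.toLp 2 x)) (by simpa using hx)
    rw [hC.1, hinner] at h1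
    simpa using h1
  refine ⟨fun C => e.symm (e C ^ (-(1 / 2) : ℝ)), ?_, fun C hC => ⟨?_, ?_, ?_⟩⟩
  · exact hc'.comp_continuousOn (continuousOn_matrix_rpow.comp hc.continuousOn hpos)
  · rw [hsymm, e.apply_symm_apply]
    exact matrix_rpow_isHermitian _
  · apply e.injective
    rw [map_mul, map_mul, e.apply_symm_apply, map_one]
    exact matrix_rpow_mul (hpos C hC)
  · intro D hD
    have h1 : Commute (e C) (e D) := hD.map e
    have h2 := (matrix_rpow_commute h1).map e.symm
    rwa [e.symm_apply_apply] at h2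

end InverseSquareRoot

/-! ### Compatible complex structures and the symplectic maps between them -/

namespace SymplecticModel

variable {n : ℕ} {V : Type*} [NormedAddCommGroup V] [InnerProductSpace ℝ V]
  (S : SymplecticModel n V)

/-- The compatible positive complex structures on a symplectic vector space. -/
structure IsCompatible (K : V →L[ℝ] V) : Prop where
  apply_apply : ∀ u, K (K u) = -u
  symm : ∀ u v, S.form (K u) v = S.form (K v) u
  pos : ∀ u, u ≠ 0 → 0 < S.form (K u) u

theorem form_swap (u v : V) : S.form u v = -S.form v u := by
  have h := S.form_self (u + v)
  simp only [map_add, add_apply, S.form_self] at h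
  linarith

theorem form_J (u v : V) : S.form u v = -inner ℝ (S.J u) v := by
  rw [S.inner_eq, S.J_J]
  simp

theorem isCompatible_J : S.IsCompatible S.J where
  apply_apply := S.J_J
  symm u v := by rw [← S.inner_eq, ← S.inner_eq, real_inner_comm]
  pos u hu := by rw [← S.inner_eq]; exact real_inner_self_pos.2 hu

variable {S} in
theorem IsCompatible.form_apply {K : V →L[ℝ] V} (h : S.IsCompatible K) (u v : V) :
    S.form (K u) v = -S.form u (K v) := by
  rw [h.symm, S.form_swap]

/-- The operator `-(K + J₀)²`. -/
def negSq (K : V →L[ℝ] V) : V →L[ℝ] V := -((K + S.J) * (K + S.J))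

variable {S} in
-- Both sides are `KJ₀ - 1`, since `K² = J₀² = -1`. Thus `K + J₀` already intertwines `J₀` with `K`;
-- it only has to be normalised to become symplectic.
theorem IsCompatible.add_mul_J {K : V →L[ℝ] V} (h : S.IsCompatible K) (u : V) :
    (K + S.J) (S.J u) = K ((K + S.J) u) := by
  simp [S.J_J, h.apply_apply, add_comm]

variable {S} in
theorem IsCompatible.J_mul_add {K : V →L[ℝ] V} (h : S.IsCompatible K) (u : V) :
    S.J ((K + S.J) u) = (K + S.J) (K u) := by
  simp [S.J_J, h.apply_apply, add_comm]

variable {S} in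
theorem IsCompatible.form_add {K : V →L[ℝ] V} (h : S.IsCompatible K) (u v : V) :
    S.form ((K + S.J) u) v = -S.form u ((K + S.J) v) := by
  simp only [add_apply, map_add, h.form_apply, S.isCompatible_J.form_apply]
  ring

variable {S} in
-- `K + J₀` exchanges `J₀` and `K` in both directions, so its square commutes with `J₀`.
theorem IsCompatible.negSq_commute {K : V →L[ℝ] V} (h : S.IsCompatible K) :
    Commute (S.negSq K) S.J := by
  ext u
  change -((K + S.J) ((K + S.J) (S.J u))) = S.J (-((K + S.J) ((K + S.J) u)))
  rw [h.add_mul_J, map_neg, h.J_mul_add]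

variable {S} in
-- Skewness of `K + J₀` for `ω₀` exhibits `-(K + J₀)²` as the pullback under `K + J₀` of the scalar
-- product `ω₀(K·, ·)`.
theorem IsCompatible.inner_negSq {K : V →L[ℝ] V} (h : S.IsCompatible K) (u v : V) :
    inner ℝ (S.negSq K u) v = S.form (K ((K + S.J) u)) ((K + S.J) v) := by
  rw [S.inner_eq]
  change S.form (S.J (-((K + S.J) ((K + S.J) u)))) v = _
  rw [map_neg, h.J_mul_add, map_neg, neg_apply, h.form_add, neg_neg]

variable {S} in
-- After `inner_negSq` only injectivity of `K + J₀` is at stake. If it killed `u ≠ 0`, the positive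
-- numbers `ω₀(Ku, u)` and `ω₀(J₀u, u)` would add up to zero.
theorem IsCompatible.isSymmPosDef_negSq {K : V →L[ℝ] V} (h : S.IsCompatible K) :
    IsSymmPosDef (S.negSq K) := by
  refine ⟨fun u v => ?_, fun u hu => ?_⟩
  · rw [h.inner_negSq, real_inner_comm, h.inner_negSq, h.symm]
  · rw [h.inner_negSq]
    refine h.pos _ fun h0 => ?_
    have h1 : S.form ((K + S.J) u) u = 0 := by rw [h0]; simp
    have h2 := h.pos u hu
    have h3 := S.isCompatible_J.pos u hu
    simp only [add_apply, map_add] at h1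
    linarith

variable [FiniteDimensional ℝ V]

/-- The symplectic group acts transitively on compatible complex structures; a symplectic map that
takes `J₀` to `K` can be chosen to depend continuously on `K`. -/
theorem exists_symplectic_conj : ∃ A : (V →L[ℝ] V) → (V →L[ℝ] V),
    ContinuousOn A {K | S.IsCompatible K} ∧
    ∀ K, S.IsCompatible K → (∀ u v, S.form (A K u) (A K v) = S.form u v) ∧
      ∀ u, A K (S.J u) = K (A K u) := by
  obtain ⟨R, hR, hR'⟩ := exists_inverse_sqrt (V := V)
  -- This is `(K + J₀) C^{-1/2}` with `C = -(K + J₀)²`. Since `ω₀((K + J₀)u, (K + J₀)v) = ω₀(u,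
  -- Cv)`, the factor `C^{-1/2}` is the normalisation that makes the map symplectic.
  refine ⟨fun K => (K + S.J) * R (S.negSq K), ?_, fun K hK => ?_⟩
  · have h1 : Continuous fun K : V →L[ℝ] V => K + S.J := by fun_prop
    have h2 : Continuous S.negSq := (h1.mul h1).neg
    exact h1.continuousOn.mul
      (hR.comp h2.continuousOn fun K hK => IsCompatible.isSymmPosDef_negSq hK)
  · obtain ⟨hs, hm, hc⟩ := hR' _ hK.isSymmPosDef_negSq
    have hJ : ∀ u, R (S.negSq K) (S.J u) = S.J (R (S.negSq K) u) := fun u =>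
      DFunLike.congr_fun (hc _ hK.negSq_commute) u
    have hC : ∀ u, S.negSq K (R (S.negSq K) u) = R (S.negSq K) (S.negSq K u) := fun u =>
      DFunLike.congr_fun (hc _ (Commute.refl _)).symm u
    refine ⟨fun u v => ?_, fun u => ?_⟩
    · change S.form ((K + S.J) (R (S.negSq K) u)) ((K + S.J) (R (S.negSq K) v)) = _
      rw [hK.form_add]
      have h1 : -S.form (R (S.negSq K) u) ((K + S.J) ((K + S.J) (R (S.negSq K) v))) =
          S.form (R (S.negSq K) u) (S.negSq K (R (S.negSq K) v)) := by
        rw [← map_neg]; rfl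
      -- Being symmetric for `g₀` and commuting with `J₀`, the root `R` can be moved across `ω₀`;
      -- then `R² C = 1` finishes.
      rw [h1, hC, S.form_J, ← hJ, hs, ← hC, ← hC, ← S.form_J]
      rw [hC, hC]
      congr 1
      exact DFunLike.congr_fun hm v
    · change (K + S.J) (R (S.negSq K) (S.J u)) = K ((K + S.J) (R (S.negSq K) u))
      rw [hJ, hK.add_mul_J]

/-- A symplectic operator as an element of the symplectic group. -/
theorem exists_mem_Sp (A : V →L[ℝ] V) (hA : ∀ u v, S.form (A u) (A v) = S.form u v) :
    ∃ a : S.Sp, a.1.1 = A := by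
  have hinj : Function.Injective A := by
    rw [injective_iff_map_eq_zero]
    intro u hu
    refine S.form_nondegenerate fun v => ?_
    rw [← hA, hu]
    simp
  have hu : IsUnit A := by
    have h1 : IsUnit (A : V →ₗ[ℝ] V) := (LinearMap.isUnit_iff_ker_eq_bot _).2
      (LinearMap.ker_eq_bot.2 hinj)
    obtain ⟨e, he⟩ := (Module.End.isUnit_iff _).1 h1 |> fun h =>
      (⟨LinearEquiv.ofBijective _ h, rfl⟩ : ∃ e : V ≃ₗ[ℝ] V, (e : V →ₗ[ℝ] V) = A)
    refine ⟨ContinuousLinearEquiv.toUnit e.toContinuousLinearEquiv, ?_⟩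
    ext v
    exact DFunLike.congr_fun he v
  obtain ⟨a, ha⟩ := hu
  refine ⟨⟨a, fun u v => ?_⟩, ha⟩
  rw [ha]
  exact hA u v

/-- The invertible elements of a complete normed algebra carry the norm topology, so continuity into
the symplectic group needs no separate check of inverses. -/
theorem isInducing_Sp : Topology.IsInducing fun a : S.Sp => a.1.1 := by
  have : CompleteSpace V := FiniteDimensional.complete ℝ V
  exact (Units.isOpenEmbedding_val (R := V →L[ℝ] V)).isInducing.comp Topology.IsInducing.subtypeVal

/-- A continuous choice of symplectic maps that take `J₀` to a given compatible complex
structure. -/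
theorem exists_Sp_conj : ∃ A : (V →L[ℝ] V) → S.Sp, ContinuousOn A {K | S.IsCompatible K} ∧
    ∀ K, S.IsCompatible K → ∀ u, S.toEquiv (A K) (S.J u) = K (S.toEquiv (A K) u) := by
  obtain ⟨A, hA, hA'⟩ := S.exists_symplectic_conj
  have h : ∀ K, ∃ a : S.Sp, S.IsCompatible K → a.1.1 = A K := by
    intro K
    by_cases hK : S.IsCompatible K
    · obtain ⟨a, ha⟩ := S.exists_mem_Sp (A K) (hA' K hK).1
      exact ⟨a, fun _ => ha⟩
    -- The identity is a default value outside the compatible structures and plays no role.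
    · exact ⟨1, fun h => absurd h hK⟩
  choose a ha using h
  refine ⟨a, ?_, fun K hK u => ?_⟩
  · rw [S.isInducing_Sp.continuousOn_iff]
    exact hA.congr fun K hK => ha K hK
  · have h1 : ∀ v, S.toEquiv (a K) v = A K v := fun v => DFunLike.congr_fun (ha K hK) v
    rw [h1, h1]
    exact (hA' K hK).2 u

end SymplecticModel

/-! ### Vector-valued forms in coordinates and smoothness of pullbacks -/

section CoordinateForms

variable {W : Type*} [NormedAddCommGroup W] [NormedSpace ℝ W] [FiniteDimensional ℝ W]

/-- The alternating form `(1 / k!) ∑_σ sgn(σ) ∏_l b^*_{I_l}(v_{σ(l)})` attached to a multi-index `I`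
of the standard basis `b`. -/
def coordForm (W : Type*) [NormedAddCommGroup W] [NormedSpace ℝ W] [FiniteDimensional ℝ W] {k : ℕ}
    (I : Fin k → Fin (Module.finrank ℝ W)) : W [⋀^Fin k]→L[ℝ] ℝ :=
  ((k.factorial : ℝ)⁻¹) • ContinuousMultilinearMap.alternatization
    ((ContinuousMultilinearMap.mkPiAlgebra ℝ (Fin k) ℝ).compContinuousLinearMap
      fun l => LinearMap.toContinuousLinearMap ((Module.finBasis ℝ W).coord (I l)))

theorem coordForm_apply {k : ℕ} (I : Fin k → Fin (Module.finrank ℝ W)) (v : Fin k → W) :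
    coordForm W I v = ((k.factorial : ℝ)⁻¹) * ∑ s : Equiv.Perm (Fin k),
      (Equiv.Perm.sign s : ℝ) * ∏ l, (Module.finBasis ℝ W).repr (v (s l)) (I l) := by
  simp [coordForm, ContinuousMultilinearMap.alternatization_apply_apply, Units.smul_def]

/-- Alternating forms are determined by their values on basis vectors. -/
theorem sum_coordForm_smul {X : Type*} [AddCommGroup X] [Module ℝ X] [TopologicalSpace X] {k : ℕ}
    (φ : W [⋀^Fin k]→L[ℝ] X) (v : Fin k → W) :
    φ v = ∑ I : Fin k → Fin (Module.finrank ℝ W),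
      coordForm W I v • φ fun l => Module.finBasis ℝ W (I l) := by
  set b := Module.finBasis ℝ W
  have h1 : ∀ w : Fin k → W, φ w = ∑ I : Fin k → Fin (Module.finrank ℝ W),
      (∏ l, b.repr (w l) (I l)) • φ fun l => b (I l) := by
    intro w
    have h2 : φ w = φ.toMultilinearMap (fun l => ∑ i, b.repr (w l) i • b i) :=
      congrArg φ (funext fun l => (b.sum_repr (w l)).symm)
    rw [h2, MultilinearMap.map_sum]
    exact Finset.sum_congr rfl fun I' _ => φ.toMultilinearMap.map_smul_univ _ _
  have h3 : ∀ s : Equiv.Perm (Fin k), φ v = (Equiv.Perm.sign s : ℝ) • φ (v ∘ s) := by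
    intro s
    have h4 : φ (v ∘ s) = Equiv.Perm.sign s • φ v := φ.toAlternatingMap.map_perm v s
    rw [h4, Units.smul_def, ← Int.cast_smul_eq_zsmul ℝ, smul_smul, ← Int.cast_mul,
      ← Units.val_mul, Int.units_mul_self]
    simp
  -- Averaging over all `k!` permutations makes the coefficients of the expansion alternating in
  -- `v`. This is why the sum may run over all multi-indices, with the factor `1/k!` hidden in
  -- `coordForm`.
  have h5 : φ v = ((k.factorial : ℝ)⁻¹) • ∑ s : Equiv.Perm (Fin k),
      (Equiv.Perm.sign s : ℝ) • φ (v ∘ s) := by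
    rw [← Finset.sum_congr rfl fun s _ => h3 s, Finset.sum_const, Finset.card_univ,
      Fintype.card_perm, Fintype.card_fin, ← Nat.cast_smul_eq_nsmul ℝ, smul_smul,
      inv_mul_cancel₀ (by positivity), one_smul]
  calc φ v = ((k.factorial : ℝ)⁻¹) • ∑ s : Equiv.Perm (Fin k), (Equiv.Perm.sign s : ℝ) •
        ∑ I : Fin k → Fin (Module.finrank ℝ W),
          (∏ l, b.repr (v (s l)) (I l)) • φ fun l => b (I l) :=
        h5.trans (congrArg _ (Finset.sum_congr rfl fun s _ => congrArg _ (h1 (v ∘ s))))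
    _ = _ := by
        simp only [coordForm_apply, Finset.smul_sum, Finset.mul_sum, Finset.sum_smul, smul_smul]
        exact Finset.sum_comm

variable {X : Type*} [NormedAddCommGroup X] [NormedSpace ℂ X]

/-- The operator `u ↦ α ⊗ u`. -/
def smulRightCLM {k : ℕ} (α : W [⋀^Fin k]→L[ℝ] ℝ) (X : Type*) [NormedAddCommGroup X]
    [NormedSpace ℂ X] : X →L[ℂ] W [⋀^Fin k]→L[ℝ] X :=
  LinearMap.mkContinuous
    { toFun := fun u => α.smulRight u
      map_add' := fun u v => by ext w; simp
      map_smul' := fun c u => by ext w; exact smul_comm (α w) c u } ‖α‖ (fun u => by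
    refine ContinuousAlternatingMap.opNorm_le_bound _
      (mul_nonneg (norm_nonneg _) (norm_nonneg _)) fun w => ?_
    change ‖α w • u‖ ≤ _
    rw [norm_smul, mul_right_comm]
    gcongr
    exact α.le_opNorm w)

/-- The evaluation of forms at a tuple of vectors. -/
def evalCLM {k : ℕ} (v : Fin k → W) (X : Type*) [NormedAddCommGroup X]
    [NormedSpace ℂ X] : (W [⋀^Fin k]→L[ℝ] X) →L[ℂ] X :=
  LinearMap.mkContinuous
    { toFun := fun φ => φ v
      map_add' := fun _ _ => rfl
      map_smul' := fun _ _ => rfl } (∏ l, ‖v l‖) (fun φ => by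
    rw [mul_comm]
    exact φ.le_opNorm v)

/-- A form is rebuilt by fixed bounded operators from its finitely many values on basis tuples.
Convergence of forms thereby reduces to convergence of values, even for infinite-dimensional `X`. -/
theorem sum_smulRightCLM {k : ℕ} (φ : W [⋀^Fin k]→L[ℝ] X) :
    φ = ∑ I : Fin k → Fin (Module.finrank ℝ W),
      smulRightCLM (coordForm W I) X (φ fun l => Module.finBasis ℝ W (I l)) := by
  ext v
  rw [sum_coordForm_smul φ v, ContinuousAlternatingMap.sum_apply]
  rfl

/-- Convergence of forms is pointwise convergence. -/
theorem tendsto_forms {Z : Type*} {l : Filter Z} {k : ℕ} {f : Z → W [⋀^Fin k]→L[ℝ] X}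
    {a : W [⋀^Fin k]→L[ℝ] X} (h : ∀ v, Filter.Tendsto (fun z => f z v) l (nhds (a v))) :
    Filter.Tendsto f l (nhds a) := by
  rw [sum_smulRightCLM a, funext fun z => sum_smulRightCLM (f z)]
  refine tendsto_finsetSum _ fun I _ => ?_
  exact ((smulRightCLM (coordForm W I) X).continuous.tendsto _).comp (h _)

/-- The pullback of forms by a linear map, as a bounded operator. -/
def pullback (N : ℕ) (X : Type*) [NormedAddCommGroup X] [NormedSpace ℂ X] (A : W →L[ℝ] W) :
    Forms N W X →L[ℂ] Forms N W X :=
  ∑ k : Fin (N + 1), ∑ I : Fin k → Fin (Module.finrank ℝ W),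
    ∑ I' : Fin k → Fin (Module.finrank ℝ W),
      (coordForm W I' fun l => A (Module.finBasis ℝ W (I l))) •
        (ContinuousLinearMap.single ℂ (fun k : Fin (N + 1) => W [⋀^Fin k]→L[ℝ] X) k ∘L
          smulRightCLM (coordForm W I) X ∘L evalCLM (fun l => Module.finBasis ℝ W (I' l)) X ∘L
          ContinuousLinearMap.proj k)

/-- The basis expansion is used twice: for the pulled back form, and then for each of its values
`f(A b_{I₁}, …, A b_{I_k})`. -/
theorem pullback_apply {N : ℕ} (A : W →L[ℝ] W) (f : Forms N W X) :
    pullback N X A f = Forms.map A (ContinuousLinearMap.id ℂ X) f := by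
  funext j
  ext v
  have h1 : Forms.map A (ContinuousLinearMap.id ℂ X) f j v = f j fun l => A (v l) := rfl
  have h2 := sum_coordForm_smul (Forms.map A (ContinuousLinearMap.id ℂ X) f j) v
  have h3 : ∀ I : Fin j → Fin (Module.finrank ℝ W), (Forms.map A (ContinuousLinearMap.id ℂ X) f j)
      (fun l => Module.finBasis ℝ W (I l)) = f j fun l => A (Module.finBasis ℝ W (I l)) :=
    fun _ => rfl
  rw [h2]
  simp only [h3]
  simp only [pullback, sum_apply, Finset.sum_apply, ContinuousAlternatingMap.sum_apply]
  -- Inclusion after projection in degree `i` contributes to the component of degree `j` only for `i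
  -- = j`.
  rw [Finset.sum_eq_single j]
  · refine Finset.sum_congr rfl fun I _ => ?_
    rw [sum_coordForm_smul (f j) fun l => A (Module.finBasis ℝ W (I l)), Finset.smul_sum]
    refine Finset.sum_congr rfl fun I' _ => ?_
    rw [smul_comm]
    simp [smulRightCLM, evalCLM]
  · intro i _ hi
    refine Finset.sum_eq_zero fun I _ => Finset.sum_eq_zero fun I' _ => ?_
    simp [hi.symm]
  · simp

theorem pullback_comp {N : ℕ} (A A' : W →L[ℝ] W) (f : Forms N W X) :
    pullback N X A' (pullback N X A f) = pullback N X (A.comp A') f := by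
  simp only [pullback_apply, Forms.map_map]
  rfl

theorem isUnit_pullback {N : ℕ} (A : W ≃L[ℝ] W) : IsUnit (pullback N X (A : W →L[ℝ] W)) := by
  have h : ∀ B : W ≃L[ℝ] W,
      pullback N X (B : W →L[ℝ] W) * pullback N X (B.symm : W →L[ℝ] W) = 1 := by
    intro B
    ext1 f
    change pullback N X (B : W →L[ℝ] W) (pullback N X (B.symm : W →L[ℝ] W) f) = f
    rw [pullback_comp, pullback_apply, ContinuousLinearEquiv.coe_symm_comp_coe]
    exact Forms.map_id f
  exact ⟨⟨_, _, h A, h A.symm⟩, rfl⟩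

/-- All dependence on `A` sits in finitely many scalar coefficients in front of fixed bounded
operators, and each coefficient is a multilinear form evaluated at images of basis vectors. This
yields smoothness in the operator norm from smoothness of `m ↦ A m v` for each `v`. -/
theorem contMDiffOn_pullback {E' H' : Type*} [NormedAddCommGroup E'] [NormedSpace ℝ E']
    [TopologicalSpace H'] {I' : ModelWithCorners ℝ E' H'} {M : Type*} [TopologicalSpace M]
    [ChartedSpace H' M] {N : ℕ} {r : ℕ∞ω} {s : Set M} {A : M → W →L[ℝ] W}
    (hA : ∀ v, ContMDiffOn I' 𝓘(ℝ, W) r (fun m => A m v) s) :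
    ContMDiffOn I' 𝓘(ℝ, Forms N W X →L[ℂ] Forms N W X) r (fun m => pullback N X (A m)) s := by
  unfold pullback
  refine contMDiffOn_finsetSum fun k _ => ?_
  refine contMDiffOn_finsetSum fun I _ => ?_
  refine contMDiffOn_finsetSum fun J _ => ?_
  have h1 : ContDiff ℝ r fun v : Fin k → W => coordForm W J v :=
    (coordForm W J).toContinuousMultilinearMap.contDiff
  have h2 : ContMDiffOn I' 𝓘(ℝ, ℝ) r
      (fun m => coordForm W J fun l => A m (Module.finBasis ℝ W (I l))) s :=
    h1.contMDiff.comp_contMDiffOn (contMDiffOn_pi_space.2 fun l => hA _)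
  exact h2.smul contMDiffOn_const

end CoordinateForms

/-! ### The pairing of forms: independence of the basis and invariance under isometries -/

section PairingInvariance

variable {W W' X Y : Type*}
  [AddCommGroup W] [Module ℝ W] [TopologicalSpace W] [Module.Finite ℝ W]
  [AddCommGroup W'] [Module ℝ W'] [TopologicalSpace W'] [Module.Finite ℝ W']

/-- The inverse Gram matrix is contravariant: `(aᵀGa)⁻¹ = a⁻¹G⁻¹(aᵀ)⁻¹`. The two index types differ,
so `a` is first made square by `e`. Invertibility of `G` is not needed, because the conventional
inverse reverses products in any case. -/
theorem mul_inv_gram_mul_transpose {ι κ : Type*} [Fintype ι] [Fintype κ] [DecidableEq ι]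
    [DecidableEq κ] (G : Matrix ι ι ℝ) (a : Matrix ι κ ℝ) (c : Matrix κ ι ℝ) (hac : a * c = 1)
    (e : κ ≃ ι) : a * (a.transpose * G * a)⁻¹ * a.transpose = G⁻¹ := by
  set a' : Matrix ι ι ℝ := a.submatrix id e.symm with ha'
  have hdet : IsUnit a'.det := by
    refine Matrix.isUnit_det_of_right_inverse (B := c.submatrix e.symm id) ?_
    rw [ha', Matrix.submatrix_mul_equiv, hac]
    simp
  have hdet' : IsUnit a'.transpose.det := by rwa [Matrix.det_transpose]
  have h1 : a * (a.transpose * G * a)⁻¹ * a.transpose =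
      a' * (a'.transpose * G * a')⁻¹ * a'.transpose := by
    have h2 : a'.transpose * G * a' = (a.transpose * G * a).submatrix e.symm e.symm := by
      ext i j
      simp [ha', Matrix.mul_apply]
    rw [h2, Matrix.inv_submatrix_equiv, ha', Matrix.submatrix_mul_equiv, Matrix.transpose_submatrix,
      Matrix.submatrix_mul_equiv]
    simp
  rw [h1, Matrix.mul_inv_rev, Matrix.mul_inv_rev, ← Matrix.mul_assoc,
    Matrix.mul_nonsing_inv _ hdet, Matrix.one_mul, Matrix.mul_assoc,
    Matrix.nonsing_inv_mul _ hdet', Matrix.mul_one]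

variable [AddCommGroup X] [Module ℝ X] [TopologicalSpace X] [AddCommGroup Y] [Module ℝ Y]

theorem map_sum_smul {ι κ : Type*} [Fintype ι] {k : ℕ} (χ : W [⋀^Fin k]→L[ℝ] X) (b : ι → W)
    (a : ι → κ → ℝ) (I : Fin k → κ) :
    χ (fun l => ∑ i, a i (I l) • b i) =
      ∑ I' : Fin k → ι, (∏ l, a (I' l) (I l)) • χ fun l => b (I' l) := by
  classical
  change χ.toMultilinearMap (fun l => ∑ i, a i (I l) • b i) = _
  rw [MultilinearMap.map_sum]
  exact Finset.sum_congr rfl fun I' _ => χ.toMultilinearMap.map_smul_univ _ _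

/-- The pairing of forms can be computed in any basis. -/
theorem formPairing_eq_sum_basis {κ : Type*} [Fintype κ] [DecidableEq κ]
    (g : W →L[ℝ] W →L[ℝ] ℝ) (B : X →ₗ[ℝ] X →ₗ[ℝ] Y) (b' : Module.Basis κ ℝ W) {k : ℕ}
    (φ ψ : W [⋀^Fin k]→L[ℝ] X) :
    formPairing g B φ ψ = ((k.factorial : ℝ)⁻¹) • ∑ I : Fin k → κ, ∑ J : Fin k → κ,
      (∏ l, (Matrix.of fun i j => g (b' i) (b' j))⁻¹ (I l) (J l)) •
        B (φ fun l => b' (I l)) (ψ fun l => b' (J l)) := by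
  set b := Module.finBasis ℝ W with hb
  set G : Matrix _ _ ℝ := Matrix.of fun i j => g (b i) (b j) with hG
  set G' : Matrix κ κ ℝ := Matrix.of fun i j => g (b' i) (b' j) with hG'
  set a : Matrix _ κ ℝ := b.toMatrix b' with ha
  have hAb : ∀ j, b' j = ∑ i, a i j • b i := fun j => (b.sum_repr (b' j)).symm
  have hGa : a.transpose * G * a = G' := by
    ext i j
    simp only [hG', Matrix.of_apply]
    rw [hAb, hAb]
    simp only [map_sum, map_smul, sum_apply, smul_apply, smul_eq_mul]
    simp only [Matrix.mul_apply, Matrix.transpose_apply, hG, Matrix.of_apply]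
    refine Finset.sum_congr rfl fun x _ => ?_
    rw [Finset.sum_mul, Finset.mul_sum]
    refine Finset.sum_congr rfl fun y _ => by ring
  have hP : a * G'⁻¹ * a.transpose = G⁻¹ := by
    rw [← hGa]
    exact mul_inv_gram_mul_transpose G a (b'.toMatrix b) (b.toMatrix_mul_toMatrix_flip b')
      (b'.indexEquiv b)
  have key : ∀ (χ : W [⋀^Fin k]→L[ℝ] X) (I : Fin k → κ), χ (fun l => b' (I l)) =
      ∑ I' : Fin k → Fin (Module.finrank ℝ W), (∏ l, a (I' l) (I l)) • χ (fun l => b (I' l)) := by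
    intro χ I
    exact (congrArg χ (funext fun l => hAb (I l))).trans (map_sum_smul χ b a I)
  -- The product over `l` of the entrywise transformation rules, expanded into a sum over
  -- multi-indices.
  have hprod : ∀ I' J' : Fin k → Fin (Module.finrank ℝ W),
      ∏ l, G⁻¹ (I' l) (J' l) = ∑ I : Fin k → κ, ∑ J : Fin k → κ, (∏ l, G'⁻¹ (I l) (J l)) *
          ((∏ l, a (I' l) (I l)) * ∏ l, a (J' l) (J l)) := by
    intro I' J'
    have h1 : ∀ l, G⁻¹ (I' l) (J' l) = ∑ i, ∑ j, G'⁻¹ i j * (a (I' l) i * a (J' l) j) := by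
      intro l
      conv_lhs => rw [← hP]
      simp only [Matrix.mul_apply, Matrix.transpose_apply, Finset.sum_mul]
      rw [Finset.sum_comm]
      exact Finset.sum_congr rfl fun i _ => Finset.sum_congr rfl fun j _ => by ring
    simp only [h1]
    rw [Finset.prod_univ_sum, Fintype.piFinset_univ]
    refine Finset.sum_congr rfl fun I _ => ?_
    rw [Finset.prod_univ_sum, Fintype.piFinset_univ]
    refine Finset.sum_congr rfl fun J _ => ?_
    rw [Finset.prod_mul_distrib, Finset.prod_mul_distrib]
  unfold formPairing
  congr 1
  simp only [← hb, ← hG, key, map_sum, map_smul, LinearMap.sum_apply, LinearMap.smul_apply,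
    Finset.smul_sum, smul_smul, hprod, Finset.sum_smul]
  -- After expansion the left side sums over the new indices inside the old ones with `hprod`
  -- inserted on the other side; only the order of summation differs.
  have e1 : ∀ F : (Fin k → Fin (Module.finrank ℝ W)) → (Fin k → Fin (Module.finrank ℝ W)) →
      (Fin k → κ) → (Fin k → κ) → Y,
      ∑ I, ∑ J, ∑ I', ∑ J', F I J I' J' = ∑ I', ∑ J', ∑ J, ∑ I, F I J I' J' := by
    intro F
    simp only [← Fintype.sum_prod_type']
    exact Fintype.sum_equiv
      ⟨fun x => (x.2.2.1, x.2.2.2, x.2.1, x.1), fun y => (y.2.2.2, y.2.2.1, y.1, y.2.1),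
        fun _ => rfl, fun _ => rfl⟩ _ _ fun _ => rfl
  rw [e1]
  refine Finset.sum_congr rfl fun I _ => Finset.sum_congr rfl fun J _ =>
    Finset.sum_congr rfl fun J' _ => Finset.sum_congr rfl fun I' _ => ?_
  congr 1
  ring

/-- Isometries between different spaces preserve the pairing of forms. -/
theorem formPairing_isometry (g : W →L[ℝ] W →L[ℝ] ℝ) (g' : W' →L[ℝ] W' →L[ℝ] ℝ)
    (B : X →ₗ[ℝ] X →ₗ[ℝ] Y) (A : W' ≃L[ℝ] W) (hA : ∀ u v, g (A u) (A v) = g' u v) {k : ℕ}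
    (φ ψ : W [⋀^Fin k]→L[ℝ] X) :
    formPairing g' B (φ.compContinuousLinearMap (A : W' →L[ℝ] W))
      (ψ.compContinuousLinearMap (A : W' →L[ℝ] W)) = formPairing g B φ ψ := by
  -- In the image under `A` of the basis of `W'`, the Gram matrix for `g` is that of `g'` and the
  -- forms take the same values as their pullbacks, so the two sums coincide.
  rw [formPairing_eq_sum_basis g B ((Module.finBasis ℝ W').map A.toLinearEquiv)]
  unfold formPairing
  simp only [Module.Basis.map_apply, ContinuousLinearEquiv.coe_toLinearEquiv, hA]
  rfl

variable {E : Type*} [NormedAddCommGroup E] [InnerProductSpace ℂ E] [CompleteSpace E] {N : ℕ}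

/-- An isometry leaves the scalar factor unchanged, and a unitary operator turns `u^♯ ⊗ v` into its
conjugate. Allowing `W ≠ W'` is essential: the maps in question are frames, between `V` and a
tangent space. -/
theorem Forms.prod_map_isometry (g : W →L[ℝ] W →L[ℝ] ℝ) (g' : W' →L[ℝ] W' →L[ℝ] ℝ)
    (A : W' ≃L[ℝ] W) (hA : ∀ u v, g (A u) (A v) = g' u v) (U : E ≃ₗᵢ[ℂ] E)
    (f h : Forms N W (HDual E)) :
    Forms.prod g' (Forms.map (A : W' →L[ℝ] W) (dualUnitary U : HDual E →L[ℂ] HDual E) f)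
      (Forms.map (A : W' →L[ℝ] W) (dualUnitary U : HDual E →L[ℂ] HDual E) h) =
      CH.conj U (Forms.prod g f h) := by
  have hc : ∀ x : CH E, (CH.conj U).toLinearMap.restrictScalars ℝ x = CH.conj U x := fun _ => rfl
  unfold Forms.prod
  rw [map_sum]
  refine Finset.sum_congr rfl fun k _ => ?_
  refine (formPairing_isometry g g' dualProd A hA _ _).trans ?_
  rw [← hc]
  refine formPairing_map g dualProd dualProd
    ((dualUnitary U : HDual E →L[ℂ] HDual E).restrictScalars ℝ)
    ((CH.conj U).toLinearMap.restrictScalars ℝ) ?_ (f k) (h k)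
  intro u v
  exact dualProd_dualUnitary U u v

end PairingInvariance

/-! ### The map of bundles and its algebraic properties -/

section Trivialization

variable {n : ℕ} {V : Type*} [NormedAddCommGroup V] [InnerProductSpace ℝ V]
  [FiniteDimensional ℝ V] [MeasurableSpace V] [BorelSpace V] {S : SymplecticModel n V}
  {G : Type*} [Group G] [TopologicalSpace G] [IsTopologicalGroup G] {Mp : MetaplecticGroup S G}
  {M : Type*} [TopologicalSpace M] [ChartedSpace (EE n) M] [IsManifold 𝓘(ℝ, EE n) ∞ M]
  {Ω : SymplecticForm n M} {P : Type*} [TopologicalSpace P] [MulAction Gᵐᵒᵖ P]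
  {σ : SegalShaleWeil S Mp} {Λ : MetaplecticStructure Mp Ω P} {𝒥 : CompatibleACS Ω}

/-- The form on `T_m M` that corresponds to `f` under a symplectic frame at `m` and a unitary
operator of `H`. -/
def SympFrame.pushForms (A : SympFrame S Ω) (U : S.H ≃ₗᵢ[ℂ] S.H) (f : S.HBullet) :
    FormBundle n M S.H :=
  ⟨A.base, Forms.map (A.frame.symm : TT n A.base →L[ℝ] V) (U : S.H →L[ℂ] S.H) f⟩

theorem SympFrame.pushForms_injective (A : SympFrame S Ω) (U : S.H ≃ₗᵢ[ℂ] S.H) :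
    Function.Injective (A.pushForms U) := by
  intro f f' h
  have h1 : Forms.map (A.frame.symm : TT n A.base →L[ℝ] V) (U : S.H →L[ℂ] S.H) f =
      Forms.map (A.frame.symm : TT n A.base →L[ℝ] V) (U : S.H →L[ℂ] S.H) f' := by
    simpa [SympFrame.pushForms] using h
  funext k
  ext v
  have h2 := DFunLike.congr_fun (congrFun h1 k) fun l => A.frame (v l)
  change U (f k fun l => A.frame.symm (A.frame (v l))) =
    U (f' k fun l => A.frame.symm (A.frame (v l))) at h2
  simpa using h2

theorem SympFrame.pushForms_pullForms (A : SympFrame S Ω) (U : S.H ≃ₗᵢ[ℂ] S.H)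
    (φ : Forms (2 * n) (TT n A.base) S.H) :
    A.pushForms U (Forms.map (A.frame : V →L[ℝ] TT n A.base) (U.symm : S.H →L[ℂ] S.H) φ) =
      ⟨A.base, φ⟩ := by
  unfold SympFrame.pushForms
  congr 1
  funext k
  ext v
  change U (U.symm (φ k fun l => A.frame (A.frame.symm (v l)))) = φ k v
  simp

namespace ReducedBundle

/-- The trivialization `[(q, f)] ↦ (⋀ (Λ(q)⁻¹)^* ⊗ J_q) f` of the reduced higher oscillator
bundle. -/
def toFormBundle (J : KuiperMap σ Λ) (y : ReducedBundle σ Λ 𝒥) : FormBundle n M S.H :=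
  Assoc.lift (fun q f => (Λ.Λ q.toP).pushForms (J.fib q.toP) f) (fun q g f => by
    -- The changes of frame and of fibre unitary under `g` are absorbed by the two factors of
    -- `σ^•(g)`.
    rw [MetaplecticStructure.Reduction.toP_smul, Λ.Λ_action, ← J.fib_action]
    unfold SympFrame.pushForms
    rw [MonoidHom.comp_apply, Subgroup.coe_subtype, σ.oscBullet_apply, Forms.map_map]
    rfl) y

variable (J : KuiperMap σ Λ)

theorem toFormBundle_mk (q : Λ.Reduction 𝒥) (f : S.HBullet) :
    toFormBundle J (mk σ q f) = (Λ.Λ q.toP).pushForms (J.fib q.toP) f := rfl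

theorem toFormBundle_base (y : ReducedBundle σ Λ 𝒥) : (toFormBundle J y).base = proj y :=
  Assoc.ind (C := fun y => (toFormBundle J y).base = proj y) (fun _ _ => rfl) y

theorem toFormBundle_tmul (q : Λ.Reduction 𝒥) {k : Fin (2 * n + 1)}
    (α : TT n (Λ.pr q.toP) [⋀^Fin k]→L[ℝ] ℝ) (u : S.H) :
    toFormBundle J (tmul σ q α u) =
      FormBundle.tmul α (J.toHomeomorph (Assoc.mk σ.osc q.toP u)).2 := by
  unfold tmul
  rw [toFormBundle_mk, SympFrame.pushForms]
  refine congrArg (fun φ => (⟨Λ.pr q.toP, φ⟩ : FormBundle n M S.H)) ?_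
  rw [Forms.map_tmul]
  congr 1
  ext w
  change α _ = α _
  congr 1
  funext i
  exact (Λ.Λ q.toP).frame.apply_symm_apply _

theorem exists_mk {y : ReducedBundle σ Λ 𝒥} {q : Λ.Reduction 𝒥} (h : Λ.redPr 𝒥 q = proj y) :
    ∃ f, y = mk σ q f :=
  Assoc.exists_rep (Λ.redPr_simplyTransitive 𝒥) y q h

/-- The structure group is transitive on fibres, so two points over the same base point can be
written with one frame. Every fibrewise identity is then checked on representatives. -/
theorem exists_mk_mk (x y : ReducedBundle σ Λ 𝒥) (h : proj x = proj y) :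
    ∃ q f f', x = mk σ q f ∧ y = mk σ q f' := by
  induction x using Assoc.ind with
  | h q f =>
    obtain ⟨f', hf'⟩ := exists_mk (q := q) (y := y) h
    exact ⟨q, f, f', rfl, hf'⟩

theorem toFormBundle_injective :
    Function.Injective (toFormBundle J : ReducedBundle σ Λ 𝒥 → FormBundle n M S.H) := by
  intro x y h
  have hb : proj x = proj y := by rw [← toFormBundle_base J, h, toFormBundle_base]
  obtain ⟨q, f, f', rfl, rfl⟩ := exists_mk_mk x y hb
  exact congrArg (mk σ q) (SympFrame.pushForms_injective _ _ h)

theorem toFormBundle_add (x y : ReducedBundle σ Λ 𝒥) (h : proj x = proj y)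
    (h' : (toFormBundle J x).base = (toFormBundle J y).base) :
    toFormBundle J (add x y h) = FormBundle.add (toFormBundle J x) (toFormBundle J y) h' := by
  obtain ⟨q, f, f', rfl, rfl⟩ := exists_mk_mk x y h
  rw [add_mk, toFormBundle_mk, SympFrame.pushForms, Forms.map_add]
  rfl

theorem toFormBundle_smul (c : ℂ) (x : ReducedBundle σ Λ 𝒥) :
    toFormBundle J (smul c x) = FormBundle.smul c (toFormBundle J x) := by
  induction x using Assoc.ind with
  | h q f =>
    change toFormBundle J (mk σ q (c • f)) = _
    rw [toFormBundle_mk, SympFrame.pushForms, Forms.map_smul]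
    rfl

/-- Over the frame `q`, the inverse of `J_CH` is conjugation by the inverse of the fibre unitary of
`L²(L)`. -/
theorem act_mk (q : Λ.Reduction 𝒥) (f : S.HBullet) (a : CH S.Hilb) :
    act J (mk σ q f) a = mk σ q (f.act ((CH.conj (J.fibCheck q.toP)).symm a)) := by
  have h : invOnCH J (mk σ q f) a = Assoc.mk _ q ((CH.conj (J.fibCheck q.toP)).symm a) := by
    refine (existsUnique_onCH J (mk σ q f) a).unique (onCH_invOnCH J _ a) ?_
    exact Prod.ext rfl ((CH.conj (J.fibCheck q.toP)).apply_symm_apply a)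
  -- The compatibility of base points is a proof depending on `b`, so the equality is substituted
  -- with `b` and `hp` both free.
  have key : ∀ b hp, b = Assoc.mk _ q ((CH.conj (J.fibCheck q.toP)).symm a) →
      actBundle (mk σ q f) b hp = mk σ q (f.act ((CH.conj (J.fibCheck q.toP)).symm a)) := by
    rintro _ hp rfl
    exact actBundle_mk q f _
  exact key _ _ h

/-- With `Ǔ` the fibre unitary of `L²(L)`, whose dual is `J_q`, the claim is `(u ∘ Ǔ⁻¹aǓ) ∘ Ǔ⁻¹ = (u
∘ Ǔ⁻¹) ∘ a`. -/
theorem toFormBundle_act (x : ReducedBundle σ Λ 𝒥) (a : CH S.Hilb) :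
    toFormBundle J (act J x a) = FormBundle.act (toFormBundle J x) a := by
  induction x using Assoc.ind with
  | h q f =>
    change toFormBundle J (act J (mk σ q f) a) = FormBundle.act (toFormBundle J (mk σ q f)) a
    rw [act_mk, toFormBundle_mk, toFormBundle_mk]
    refine congrArg (fun φ => (⟨Λ.pr q.toP, φ⟩ : FormBundle n M S.H)) ?_
    have h := Forms.map_act ((Λ.Λ q.toP).frame.symm : TT n (Λ.Λ q.toP).base →L[ℝ] V)
      (J.fibCheck q.toP) f ((CH.conj (J.fibCheck q.toP)).symm a)
    rw [LinearEquiv.apply_symm_apply, KuiperMap.fibCheck, dualUnitary_sharpConj] at h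
    exact h.symm

/-- A unitary frame respects both the symplectic forms and the complex structures, hence the metrics
built from them. A general symplectic frame would not, so the product relies on the reduction to
`P_R`. -/
theorem isometry_of_isUnitary (A : SympFrame S Ω) (hA : A.IsUnitary 𝒥) (u v : TT n A.base) :
    innerSL ℝ (A.frame.symm u) (A.frame.symm v) = 𝒥.metric A.base u v := by
  have h := hA (A.frame.symm u)
  rw [A.frame.apply_symm_apply] at h
  change inner ℝ (A.frame.symm u) (A.frame.symm v) = Ω.toFun A.base (𝒥.toFun A.base u) v
  rw [S.inner_eq, ← A.symp, h, A.frame.apply_symm_apply]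

theorem toFormBundle_prod (x y : ReducedBundle σ Λ 𝒥) (h : proj x = proj y)
    (h' : (toFormBundle J x).base = (toFormBundle J y).base) :
    FormBundle.prod 𝒥 (toFormBundle J x) (toFormBundle J y) h' = prod J x y h := by
  obtain ⟨q, f, f', rfl, rfl⟩ := exists_mk_mk x y h
  unfold prod
  rw [prodBundle_mk, KuiperMap.onCH_mk]
  change Forms.prod (𝒥.metric (Λ.pr q.toP)) _ _ = _
  have h1 := Forms.prod_map_isometry (innerSL ℝ) (𝒥.metric (Λ.pr q.toP)) (Λ.Λ q.toP).frame.symm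
    (isometry_of_isUnitary _ q.2) (J.fibCheck q.toP) f f'
  rw [KuiperMap.fibCheck, dualUnitary_sharpConj] at h1
  exact h1

end ReducedBundle

end Trivialization

/-! ### Local sections of the bundle of unitary frames -/

section LocalSections

variable {n : ℕ} {V : Type*} [NormedAddCommGroup V] [InnerProductSpace ℝ V]
  {S : SymplecticModel n V}
  {M : Type*} [TopologicalSpace M] [ChartedSpace (EE n) M] [IsManifold 𝓘(ℝ, EE n) ∞ M]
  {Ω : SymplecticForm n M}

/-- The trivialization of the tangent bundle around `m₀`. -/
abbrev tangentTriv (n : ℕ) {M : Type*} [TopologicalSpace M] [ChartedSpace (EE n) M]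
    [IsManifold 𝓘(ℝ, EE n) ∞ M] (m₀ : M) :
    Bundle.Trivialization (EE n) (Bundle.TotalSpace.proj : Bundle.TotalSpace (EE n)
      (fun m : M => TT n m) → M) :=
  trivializationAt (EE n) (fun m : M => TT n m) m₀

theorem eventually_mem_baseSet (m₀ : M) : ∀ᶠ m in nhds m₀, m ∈ (tangentTriv n m₀).baseSet :=
  (tangentTriv n m₀).open_baseSet.mem_nhds (FiberBundle.mem_baseSet_trivializationAt' m₀)

/-- Inversion is continuous at invertible operators. The value of `inverse` at non-invertible ones
does not matter, since those stay away from `A z`. -/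
theorem continuousAt_inverse {E F : Type*} [NormedAddCommGroup E] [NormedSpace ℝ E]
    [CompleteSpace E] [NormedAddCommGroup F] [NormedSpace ℝ F] {Z : Type*} [TopologicalSpace Z]
    {A : Z → E →L[ℝ] F} {z : Z} (hA : ContinuousAt A z) (e : E ≃L[ℝ] F) (he : A z = e) :
    ContinuousAt (fun z => ContinuousLinearMap.inverse (A z)) z := by
  have h : ContinuousAt ContinuousLinearMap.inverse (A z) := by
    rw [he]
    exact (contDiffAt_map_inverse (𝕜 := ℝ) (n := 0) e).continuousAt
  exact h.comp hA

namespace SympFrame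

theorem continuous_toHom : Continuous (toHom : SympFrame S Ω → _) := continuous_induced_dom

theorem continuous_base : Continuous fun A : SympFrame S Ω => A.base :=
  (FiberBundle.continuous_proj (V →L[ℝ] EE n)
    (fun m : M => Bundle.Trivial M V m →L[ℝ] TT n m)).comp continuous_toHom

/-- A frame in the coordinates around `m₀`. -/
def coord (m₀ : M) (A : SympFrame S Ω) : V →L[ℝ] EE n :=
  ((tangentTriv n m₀).continuousLinearMapAt ℝ A.base).comp (A.frame : V →L[ℝ] TT n A.base)

/-- The topology on frames is induced from a bundle of linear maps whose source bundle is trivial,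
so only the trivialization of the tangent bundle at the base point of `A` enters. -/
theorem continuousAt_coord (A : SympFrame S Ω) : ContinuousAt (coord A.base) A := by
  have h : ContinuousAt (toHom : SympFrame S Ω → _) A := continuous_toHom.continuousAt
  have h1 := ((continuousAt_hom_bundle (RingHom.id ℝ) _).1 h).2
  refine h1.congr (Filter.Eventually.of_forall fun B => ?_)
  ext v
  simp [ContinuousLinearMap.inCoordinates, coord, toHom]

/-- A frame in coordinates, as an isomorphism. -/
def coordEquiv {m₀ : M} (A : SympFrame S Ω) (h : A.base ∈ (tangentTriv n m₀).baseSet) :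
    V ≃L[ℝ] EE n :=
  A.frame.trans ((tangentTriv n m₀).continuousLinearEquivAt ℝ A.base h)

theorem coe_coordEquiv {m₀ : M} (A : SympFrame S Ω)
    (h : A.base ∈ (tangentTriv n m₀).baseSet) :
    (A.coordEquiv h : V →L[ℝ] EE n) = coord m₀ A := by
  ext v
  simp [coordEquiv, coord, Bundle.Trivialization.coe_linearMapAt_of_mem _ h]

/-- The complex structure of `V` that corresponds to the almost complex structure of `M`. -/
def complexStructure (𝒥 : CompatibleACS Ω) (A : SympFrame S Ω) : V →L[ℝ] V :=
  (A.frame.symm : TT n A.base →L[ℝ] V).comp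
    ((𝒥.toFun A.base).comp (A.frame : V →L[ℝ] TT n A.base))

theorem frame_complexStructure (𝒥 : CompatibleACS Ω) (A : SympFrame S Ω) (u : V) :
    A.frame (A.complexStructure 𝒥 u) = 𝒥.toFun A.base (A.frame u) :=
  A.frame.apply_symm_apply _

/-- A symplectic frame transports the axioms of the almost complex structure to `V`, where the
transitivity result for compatible structures applies. -/
theorem isCompatible_complexStructure (𝒥 : CompatibleACS Ω) (A : SympFrame S Ω) :
    S.IsCompatible (A.complexStructure 𝒥) where
  apply_apply u := A.frame.injective (by
    rw [frame_complexStructure, frame_complexStructure, 𝒥.apply_apply, map_neg])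
  symm u v := by
    rw [← A.symp, ← A.symp, frame_complexStructure, frame_complexStructure, 𝒥.symm]
  pos u hu := by
    rw [← A.symp, frame_complexStructure]
    exact 𝒥.pos _ _ (by simpa using hu)

theorem isUnitary_action_of_commute (𝒥 : CompatibleACS Ω) (A : SympFrame S Ω) (a : S.Sp)
    (ha : ∀ u, S.toEquiv a (S.J u) = A.complexStructure 𝒥 (S.toEquiv a u)) :
    (A.action a).IsUnitary 𝒥 := by
  intro u
  change A.frame (S.toEquiv a (S.J u)) = 𝒥.toFun A.base (A.frame (S.toEquiv a u))
  rw [ha, frame_complexStructure]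

/-- Near `A`, the map is the product of the inverse of the frame in coordinates, the almost complex
structure in coordinates, and the frame in coordinates. Each factor is continuous at `A`. -/
theorem continuous_complexStructure [CompleteSpace V] (𝒥 : CompatibleACS Ω) :
    Continuous (fun A : SympFrame S Ω => A.complexStructure 𝒥) := by
  rw [continuous_iff_continuousAt]
  intro A
  have h1 := ((continuousAt_hom_bundle (RingHom.id ℝ) _).1 (𝒥.smooth.continuous.continuousAt (x := A.base))).2
  have h2 : ContinuousAt (fun B : SympFrame S Ω => B.base) A := continuous_base.continuousAt
  have h3 := ContinuousAt.comp (f := fun B : SympFrame S Ω => B.base) h1 h2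
  have hA : A.base ∈ (tangentTriv n A.base).baseSet :=
    FiberBundle.mem_baseSet_trivializationAt' A.base
  have h4 := continuousAt_inverse A.continuousAt_coord (A.coordEquiv hA) (A.coe_coordEquiv hA).symm
  refine (h4.clm_comp (h3.clm_comp A.continuousAt_coord)).congr ?_
  filter_upwards [h2.eventually (eventually_mem_baseSet (n := n) A.base)] with B hB
  ext v
  rw [← coe_coordEquiv B hB, ContinuousLinearMap.inverse_equiv]
  simp only [Function.comp_apply, ContinuousLinearMap.comp_apply]
  rw [ContinuousLinearMap.inCoordinates_eq hB hB]
  simp only [ContinuousLinearMap.comp_apply, ContinuousLinearEquiv.coe_coe, coordEquiv,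
    ContinuousLinearEquiv.trans_apply, ContinuousLinearEquiv.symm_trans_apply,
    ContinuousLinearEquiv.symm_apply_apply, complexStructure]

end SympFrame

/-- Two-sheetedness makes the fibre over `a` nonempty, and a covering map has a continuous local
inverse through any point of its source. -/
theorem SymplecticModel.exists_local_lift {G : Type*} [Group G] [TopologicalSpace G]
    [IsTopologicalGroup G] (Mp : MetaplecticGroup S G) (a : S.Sp) : ∃ ψ : S.Sp → G,
    ContinuousAt ψ a ∧ ∀ᶠ b in nhds a, Mp.cov (ψ b) = b := by
  have hne : (Mp.cov ⁻¹' {a}).Nonempty := by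
    apply Set.nonempty_of_ncard_ne_zero
    rw [Mp.two_sheeted]
    norm_num
  obtain ⟨g, hg⟩ := hne
  obtain rfl : Mp.cov g = a := hg
  obtain ⟨f, hf, hfc⟩ := Mp.isCoveringMap.isLocalHomeomorph g
  have h1 : Mp.cov g ∈ f.target := by
    rw [hfc]
    exact f.map_source hf
  refine ⟨f.symm, f.continuousAt_symm h1, ?_⟩
  filter_upwards [f.open_target.mem_nhds h1] with b hb
  rw [hfc]
  exact f.right_inv hb

variable [FiniteDimensional ℝ V] [MeasurableSpace V] [BorelSpace V] {G : Type*} [Group G] [TopologicalSpace G] [IsTopologicalGroup G]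
  {Mp : MetaplecticGroup S G} {P : Type*} [TopologicalSpace P] [MulAction Gᵐᵒᵖ P]

theorem MetaplecticStructure.isInducing_toP {Λ : MetaplecticStructure Mp Ω P}
    {𝒥 : CompatibleACS Ω} :
    Topology.IsInducing (Reduction.toP : Λ.Reduction 𝒥 → P) :=
  Topology.IsInducing.subtypeVal

/-- The reduction to unitary frames has local sections. -/
theorem MetaplecticStructure.exists_local_section (Λ : MetaplecticStructure Mp Ω P)
    (𝒥 : CompatibleACS Ω) (m₀ : M) : ∃ s : M → Λ.Reduction 𝒥, ContinuousAt s m₀ ∧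
      ∀ᶠ m in nhds m₀, Λ.redPr 𝒥 (s m) = m := by
  have : CompleteSpace V := FiniteDimensional.complete ℝ V
  obtain ⟨e, he, -⟩ := Λ.isPrincipalBundle.locally_trivial m₀
  obtain ⟨A, hA, hA'⟩ := S.exists_Sp_conj
  -- A local section of `P`, constant in a trivialization; its frames are symplectic but need not be
  -- unitary.
  set p : M → P := fun m => e.toOpenPartialHomeomorph.symm (m, 1) with hp
  have hpc : ContinuousAt p m₀ := by
    have h1 : ((m₀, 1) : M × G) ∈ e.target := e.mem_target.2 he
    exact ContinuousAt.comp (f := fun m => (m, (1 : G)))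
      (e.toOpenPartialHomeomorph.continuousAt_symm h1) (by fun_prop)
  set K : M → V →L[ℝ] V := fun m => (Λ.Λ (p m)).complexStructure 𝒥
  have hK : ∀ m, S.IsCompatible (K m) := fun m => SympFrame.isCompatible_complexStructure _ _
  have hKc : ContinuousAt K m₀ :=
    ((SympFrame.continuous_complexStructure 𝒥).comp Λ.continuous_Λ).continuousAt.comp hpc
  have hAc : ContinuousAt (fun m => A (K m)) m₀ :=
    Filter.Tendsto.comp (hA _ (hK m₀))
      (tendsto_nhdsWithin_iff.2 ⟨hKc, Filter.Eventually.of_forall hK⟩)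
  obtain ⟨ψ, hψ, hψ'⟩ := S.exists_local_lift Mp (A (K m₀))
  have hgc : ContinuousAt (fun m => ψ (A (K m))) m₀ := ContinuousAt.comp (g := ψ) hψ hAc
  -- The frame of `p m` composed with `A (K m)`, which takes `J₀` to `K m`, is unitary. Lifting this
  -- symplectic map to the metaplectic group corrects the section inside `P`.
  set s : M → P := fun m => MulOpposite.op (ψ (A (K m))) • p m
  have hsc : ContinuousAt s m₀ :=
    ContinuousAt.comp (f := fun m => (p m, ψ (A (K m))))
      Λ.isPrincipalBundle.continuous_action.continuousAt (hpc.prodMk hgc)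
  have hspr : ∀ᶠ m in nhds m₀, Λ.pr (s m) = m := by
    filter_upwards [e.open_baseSet.mem_nhds he] with m hm
    refine (Λ.simplyTransitive.proj_action _ _).trans ?_
    exact e.proj_symm_apply' hm
  have hsu : ∀ᶠ m in nhds m₀, (Λ.Λ (s m)).IsUnitary 𝒥 := by
    filter_upwards [hAc.eventually hψ'] with m hm
    change (Λ.Λ (MulOpposite.op _ • p m)).IsUnitary 𝒥
    rw [Λ.Λ_action, hm]
    exact SympFrame.isUnitary_action_of_commute _ _ _ (hA' _ (hK m))
  have h1 : ∀ m, ∃ q : Λ.Reduction 𝒥, (Λ.Λ (s m)).IsUnitary 𝒥 → q.toP = s m := by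
    intro m
    by_cases h : (Λ.Λ (s m)).IsUnitary 𝒥
    · exact ⟨⟨s m, h⟩, fun _ => rfl⟩
    -- The value at `m₀` serves as a default away from `m₀`; only the germ at `m₀` matters.
    · exact ⟨⟨s m₀, hsu.self_of_nhds⟩, fun h' => absurd h' h⟩
  choose s' hs' using h1
  refine ⟨s', ?_, ?_⟩
  · refine isInducing_toP.continuousAt_iff.2 (hsc.congr ?_)
    filter_upwards [hsu] with m hm
    exact (hs' m hm).symm
  · filter_upwards [hsu, hspr] with m hm hm'
    change Λ.pr (s' m).toP = m
    rw [hs' m hm, hm']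

end LocalSections

/-! ### Continuity of the bundle map and of its inverse -/

section Homeomorphism

variable {n : ℕ} {V : Type*} [NormedAddCommGroup V] [InnerProductSpace ℝ V]
  [FiniteDimensional ℝ V] [MeasurableSpace V] [BorelSpace V] {S : SymplecticModel n V}
  {G : Type*} [Group G] [TopologicalSpace G] [IsTopologicalGroup G] {Mp : MetaplecticGroup S G}
  {M : Type*} [TopologicalSpace M] [ChartedSpace (EE n) M] [IsManifold 𝓘(ℝ, EE n) ∞ M]
  {Ω : SymplecticForm n M} {P : Type*} [TopologicalSpace P] [MulAction Gᵐᵒᵖ P]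
  {σ : SegalShaleWeil S Mp} {Λ : MetaplecticStructure Mp Ω P} {𝒥 : CompatibleACS Ω}

namespace Assoc

theorem continuous_mk {X : Type*} [NormedAddCommGroup X] [NormedSpace ℂ X] (κ : G →* (X ≃ₗ[ℂ] X)) :
    Continuous fun z : P × X => Assoc.mk κ z.1 z.2 :=
  continuous_quotient_mk'

end Assoc

theorem SympFrame.coordEquiv_symm_apply {m₀ : M} (A : SympFrame S Ω)
    (h : A.base ∈ (tangentTriv n m₀).baseSet) (x : EE n) :
    (A.coordEquiv h).symm x = A.frame.symm ((tangentTriv n m₀).symmL ℝ A.base x) := by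
  rw [ContinuousLinearEquiv.symm_apply_eq, ← ContinuousLinearEquiv.coe_coe, coe_coordEquiv]
  change x = (tangentTriv n m₀).continuousLinearMapAt ℝ A.base (A.frame (A.frame.symm _))
  rw [A.frame.apply_symm_apply, (tangentTriv n m₀).continuousLinearMapAt_symmL h]

namespace KuiperMap

variable (J : KuiperMap σ Λ)

theorem continuous_fib : Continuous fun z : P × S.H => J.fib z.1 z.2 :=
  continuous_snd.comp (J.toHomeomorph.continuous.comp (Assoc.continuous_mk σ.osc))

theorem continuousAt_fib {Z : Type*} [TopologicalSpace Z] {z₀ : Z} {p : Z → P} {u : Z → S.H}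
    (hp : ContinuousAt p z₀) (hu : ContinuousAt u z₀) :
    ContinuousAt (fun z => J.fib (p z) (u z)) z₀ :=
  ContinuousAt.comp (f := fun z => (p z, u z)) J.continuous_fib.continuousAt (hp.prodMk hu)

/-- With `w` the expected limit, isometry gives `‖U_z⁻¹u_z - w‖ = ‖u_z - U_z w‖`. Strong continuity
of `U_z` therefore suffices; no norm continuity is available or needed. -/
theorem continuousAt_fib_symm {Z : Type*} [TopologicalSpace Z] {z₀ : Z} {p : Z → P} {u : Z → S.H}
    (hp : ContinuousAt p z₀) (hu : ContinuousAt u z₀) :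
    ContinuousAt (fun z => (J.fib (p z)).symm (u z)) z₀ := by
  set w := (J.fib (p z₀)).symm (u z₀) with hw
  have h1 : ContinuousAt (fun z => J.fib (p z) w) z₀ :=
    J.continuousAt_fib hp continuousAt_const
  have h2 : Filter.Tendsto (fun z => ‖u z - J.fib (p z) w‖) (nhds z₀) (nhds 0) := by
    have h3 : Filter.Tendsto (fun z => ‖u z - J.fib (p z) w‖) (nhds z₀)
        (nhds ‖u z₀ - J.fib (p z₀) w‖) := (hu.sub h1).norm
    rwa [show ‖u z₀ - J.fib (p z₀) w‖ = 0 by simp [hw]] at h3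
  refine tendsto_iff_norm_sub_tendsto_zero.2 (h2.congr fun z => ?_)
  change _ = ‖(J.fib (p z)).symm (u z) - w‖
  rw [← (J.fib (p z)).norm_map ((J.fib (p z)).symm (u z) - w), map_sub,
    LinearIsometryEquiv.apply_symm_apply]

end KuiperMap

section Coordinates

variable {X : Type*} [NormedAddCommGroup X] [NormedSpace ℂ X]

theorem inCoordinates_form {k : ℕ} (m₀ m : M)
    (φ : TT n m [⋀^Fin k]→L[ℝ] Bundle.Trivial M X m) (v : Fin k → EE n) :
    ContinuousAlternatingMap.inCoordinates (EE n) X m₀ m m₀ m φ v =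
      φ fun l => (tangentTriv n m₀).symmL ℝ m (v l) := by
  simp [ContinuousAlternatingMap.inCoordinates, Function.comp_def]

theorem continuousAt_eval {Z W : Type*} [TopologicalSpace Z] [NormedAddCommGroup W]
    [NormedSpace ℝ W] {k : ℕ} {z₀ : Z} {φ : Z → W [⋀^Fin k]→L[ℝ] X} {v : Z → Fin k → W}
    (hφ : ContinuousAt φ z₀) (hv : ContinuousAt v z₀) :
    ContinuousAt (fun z => φ z (v z)) z₀ :=
  ContinuousAt.comp (g := fun x : (W [⋀^Fin k]→L[ℝ] X) × (Fin k → W) => x.1 x.2)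
    (f := fun z => (φ z, v z)) ContinuousEval.continuous_eval.continuousAt (hφ.prodMk hv)

namespace FormBundle

theorem continuous_component (k : Fin (2 * n + 1)) :
    Continuous (component k : FormBundle n M X → _) :=
  (continuous_apply k).comp
    (continuous_induced_dom : Continuous fun (y : FormBundle n M X) k => component k y)

theorem continuous_base : Continuous (base : FormBundle n M X → M) :=
  (FiberBundle.continuous_proj (EE n [⋀^Fin 0]→L[ℝ] X)
    (fun m : M => TT n m [⋀^Fin 0]→L[ℝ] Bundle.Trivial M X m)).comp (continuous_component 0)

/-- The component of degree `k` in the coordinates around `m₀`. -/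
def coord (m₀ : M) (k : Fin (2 * n + 1)) (y : FormBundle n M X) : EE n [⋀^Fin k]→L[ℝ] X :=
  ContinuousAlternatingMap.inCoordinates (EE n) X m₀ y.base m₀ y.base (component k y).2

theorem coord_apply (m₀ : M) (k : Fin (2 * n + 1)) (y : FormBundle n M X) (v : Fin k → EE n) :
    coord m₀ k y v = y.form k fun l => (tangentTriv n m₀).symmL ℝ y.base (v l) :=
  inCoordinates_form m₀ y.base (component k y).2 v

theorem continuousAt_coord (y : FormBundle n M X) (k : Fin (2 * n + 1)) :
    ContinuousAt (coord y.base k) y :=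
  ((FiberBundle.continuousAt_totalSpace _ _).1 (continuous_component k).continuousAt).2

/-- The total space carries the topology induced by its homogeneous components, and continuity into
each of these bundles is tested in the trivialization at the image point. -/
theorem continuousAt_of_coord {Z : Type*} [TopologicalSpace Z] {F : Z → FormBundle n M X} {z₀ : Z}
    (hb : ContinuousAt (fun z => (F z).base) z₀)
    (hc : ∀ k, ContinuousAt (fun z => coord (F z₀).base k (F z)) z₀) : ContinuousAt F z₀ := by
  refine (Topology.IsInducing.continuousAt_iff ⟨rfl⟩).2 (continuousAt_pi.2 fun k => ?_)
  exact (FiberBundle.continuousAt_totalSpace _ _).2 ⟨hb, hc k⟩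

end FormBundle

end Coordinates

/-- The hypothesis on `U` is only strong continuity. This is enough because convergence of forms is
tested on fixed vectors `v`, where the value is `U z` applied to a continuous curve in `H`: the form
`f z` evaluated at the preimages of `v` under the frame in coordinates. -/
theorem SympFrame.continuousAt_pushForms {Z : Type*} [TopologicalSpace Z] {z₀ : Z}
    {A : Z → SympFrame S Ω} {U : Z → S.H ≃ₗᵢ[ℂ] S.H} {f : Z → S.HBullet} (hA : ContinuousAt A z₀)
    (hU : ∀ u : Z → S.H, ContinuousAt u z₀ → ContinuousAt (fun z => U z (u z)) z₀)
    (hf : ContinuousAt f z₀) : ContinuousAt (fun z => (A z).pushForms (U z) (f z)) z₀ := by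
  have : CompleteSpace V := FiniteDimensional.complete ℝ V
  have hb : ContinuousAt (fun z => (A z).base) z₀ := continuous_base.continuousAt.comp hA
  refine FormBundle.continuousAt_of_coord hb fun k => tendsto_forms fun v => ?_
  change ContinuousAt (fun z => FormBundle.coord (A z₀).base k ((A z).pushForms (U z) (f z)) v) z₀
  have hm : (A z₀).base ∈ (tangentTriv n (A z₀).base).baseSet :=
    FiberBundle.mem_baseSet_trivializationAt' (A z₀).base
  have hc : ContinuousAt (fun z => coord (A z₀).base (A z)) z₀ :=
    ContinuousAt.comp (g := coord (A z₀).base) (A z₀).continuousAt_coord hA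
  have hi := continuousAt_inverse hc ((A z₀).coordEquiv hm) ((A z₀).coe_coordEquiv hm).symm
  have hv : ContinuousAt (fun z => fun l =>
      ContinuousLinearMap.inverse (coord (A z₀).base (A z)) (v l)) z₀ :=
    continuousAt_pi.2 fun l => hi.clm_apply continuousAt_const
  have h1 := hU _ (continuousAt_eval (continuousAt_pi.1 hf k) hv)
  refine ContinuousAt.congr h1 ?_
  filter_upwards [hb.eventually (eventually_mem_baseSet (n := n) (A z₀).base)] with z hz
  have h2 : ∀ x, ContinuousLinearMap.inverse (coord (A z₀).base (A z)) x =
      (A z).frame.symm ((tangentTriv n (A z₀).base).symmL ℝ (A z).base x) := by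
    intro x
    rw [← coe_coordEquiv _ hz, ContinuousLinearMap.inverse_equiv]
    exact coordEquiv_symm_apply _ hz x
  simp only [h2]
  exact (FormBundle.coord_apply (A z₀).base k ((A z).pushForms (U z) (f z)) v).symm

namespace ReducedBundle

variable (J : KuiperMap σ Λ)

theorem continuous_mk : Continuous fun z : Λ.Reduction 𝒥 × S.HBullet => mk σ z.1 z.2 :=
  continuous_quotient_mk'

theorem continuousAt_pushForms {Z : Type*} [TopologicalSpace Z] {z₀ : Z} {p : Z → P}
    {f : Z → S.HBullet} (hp : ContinuousAt p z₀) (hf : ContinuousAt f z₀) :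
    ContinuousAt (fun z => (Λ.Λ (p z)).pushForms (J.fib (p z)) (f z)) z₀ :=
  SympFrame.continuousAt_pushForms (U := fun z => J.fib (p z))
    (ContinuousAt.comp (g := Λ.Λ) Λ.continuous_Λ.continuousAt hp)
    (fun _ hu => J.continuousAt_fib hp hu) hf

theorem continuous_pushForms : Continuous fun z : Λ.Reduction 𝒥 × S.HBullet =>
    (Λ.Λ z.1.toP).pushForms (J.fib z.1.toP) z.2 := by
  rw [continuous_iff_continuousAt]
  intro z₀
  have hp : ContinuousAt (fun z : Λ.Reduction 𝒥 × S.HBullet => z.1.toP) z₀ :=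
    (MetaplecticStructure.isInducing_toP.continuous.comp continuous_fst).continuousAt
  exact continuousAt_pushForms J hp continuousAt_snd

theorem continuous_toFormBundle :
    Continuous (toFormBundle J : ReducedBundle σ Λ 𝒥 → FormBundle n M S.H) := by
  refine isQuotientMap_quotient_mk'.continuous_iff.2 ?_
  exact continuous_pushForms J

/-- The hypothesis on `f` is the formula for the inverse in the frame `q`, routed through
coordinates around `m₀` so that its continuity is visible. Over the base set the coordinate maps
cancel. -/
theorem eventually_toFormBundle_eq {m₀ : M} (q : Λ.Reduction 𝒥) (y : FormBundle n M S.H)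
    (hq : Λ.redPr 𝒥 q = y.base) (hy : y.base ∈ (tangentTriv n m₀).baseSet) (f : S.HBullet)
    (hf : ∀ k v, f k v = (J.fib q.toP).symm
      (FormBundle.coord m₀ k y fun l => SympFrame.coord m₀ (Λ.Λ q.toP) (v l))) :
    toFormBundle J (mk σ q f) = y := by
  obtain ⟨m, φ⟩ := y
  subst hq
  refine Eq.trans ?_ ((Λ.Λ q.toP).pushForms_pullForms (J.fib q.toP) φ)
  rw [toFormBundle_mk]
  congr 1
  funext k
  ext v
  rw [hf, FormBundle.coord_apply]
  change (J.fib q.toP).symm (φ k _) = (J.fib q.toP).symm (φ k _)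
  congr 2
  funext l
  exact (tangentTriv n m₀).symmL_continuousLinearMapAt hy _

/-- A right inverse near `y₀`, continuous at `y₀`, does double duty: it gives surjectivity, and with
injectivity it gives continuity of the global inverse. Local triviality of the quotient need not be
proved. -/
theorem exists_continuousAt_section (y₀ : FormBundle n M S.H) :
    ∃ R : FormBundle n M S.H → ReducedBundle σ Λ 𝒥, ContinuousAt R y₀ ∧
      ∀ᶠ y in nhds y₀, toFormBundle J (R y) = y := by
  obtain ⟨s, hs, hs'⟩ := Λ.exists_local_section 𝒥 y₀.base
  have hb : ContinuousAt (FormBundle.base : FormBundle n M S.H → M) y₀ :=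
    FormBundle.continuous_base.continuousAt
  have hsc : ContinuousAt (fun y : FormBundle n M S.H => s y.base) y₀ := ContinuousAt.comp hs hb
  have hp : ContinuousAt (fun y : FormBundle n M S.H => (s y.base).toP) y₀ :=
    MetaplecticStructure.isInducing_toP.continuous.continuousAt.comp hsc
  have hΛ : ContinuousAt (fun y : FormBundle n M S.H => Λ.Λ (s y.base).toP) y₀ :=
    Λ.continuous_Λ.continuousAt.comp hp
  have h0 : (Λ.Λ (s y₀.base).toP).base = y₀.base := hs'.self_of_nhds
  have hc : ContinuousAt (fun y : FormBundle n M S.H =>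
      SympFrame.coord y₀.base (Λ.Λ (s y.base).toP)) y₀ := by
    -- The coordinates are centred at the base point of the frame, which equals `y₀.base` only
    -- propositionally; hence the rewriting by `h0`.
    have h1 := (Λ.Λ (s y₀.base).toP).continuousAt_coord
    rw [h0] at h1
    exact ContinuousAt.comp (g := SympFrame.coord y₀.base) h1 hΛ
  set f : FormBundle n M S.H → S.HBullet := fun y k =>
    (((J.fib (s y.base).toP).symm : S.H →L[ℂ] S.H).restrictScalars
      ℝ).compContinuousAlternatingMap ((FormBundle.coord y₀.base k y).compContinuousLinearMap
        (SympFrame.coord y₀.base (Λ.Λ (s y.base).toP)))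
  have hf : ContinuousAt f y₀ := by
    refine continuousAt_pi.2 fun k => tendsto_forms fun v => ?_
    refine J.continuousAt_fib_symm hp ?_
    exact continuousAt_eval (φ := FormBundle.coord y₀.base k) (y₀.continuousAt_coord k)
      (continuousAt_pi.2 fun l => hc.clm_apply (continuousAt_const (y := v l)))
  refine ⟨fun y => mk σ (s y.base) (f y), ?_, ?_⟩
  · exact ContinuousAt.comp (g := fun z : Λ.Reduction 𝒥 × S.HBullet => mk σ z.1 z.2)
      continuous_mk.continuousAt (hsc.prodMk hf)
  · filter_upwards [hb.eventually hs', hb.eventually (eventually_mem_baseSet (n := n) y₀.base)]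
      with y hy hy'
    exact eventually_toFormBundle_eq J (s y.base) y hy hy' (f y) fun _ _ => rfl

theorem toFormBundle_bijective :
    Function.Bijective (toFormBundle J : ReducedBundle σ Λ 𝒥 → FormBundle n M S.H) := by
  refine ⟨toFormBundle_injective J, fun y => ?_⟩
  obtain ⟨R, -, hR⟩ := exists_continuousAt_section (𝒥 := 𝒥) J y
  exact ⟨R y, hR.self_of_nhds⟩

/-- The homeomorphism of the reduced higher oscillator bundle with `⋀^• T*M ⊗ (M × H)` induced by a
Kuiper map. -/
def homeomorphFormBundle : ReducedBundle σ Λ 𝒥 ≃ₜ FormBundle n M S.H where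
  toEquiv := Equiv.ofBijective (toFormBundle J) (toFormBundle_bijective J)
  continuous_toFun := continuous_toFormBundle J
  continuous_invFun := by
    refine continuous_iff_continuousAt.2 fun y => ?_
    obtain ⟨R, hR, hR'⟩ := exists_continuousAt_section (𝒥 := 𝒥) J y
    -- By injectivity the global inverse agrees near `y` with the local right inverse `R`.
    refine hR.congr ?_
    filter_upwards [hR'] with z hz
    have h : (Equiv.ofBijective (toFormBundle J) (toFormBundle_bijective J)).symm z = R z :=
      (Equiv.symm_apply_eq _).2 hz.symm
    exact h.symm

end ReducedBundle

end Homeomorphism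

/-! ### Transition functions in the smooth charts -/

section TransitionFunctions

variable {n : ℕ} {V : Type*} [NormedAddCommGroup V] [InnerProductSpace ℝ V]
  [FiniteDimensional ℝ V] [MeasurableSpace V] [BorelSpace V] {S : SymplecticModel n V}
  {G : Type*} [Group G] [TopologicalSpace G] [IsTopologicalGroup G] {Mp : MetaplecticGroup S G}
  {M : Type*} [TopologicalSpace M] [ChartedSpace (EE n) M] [IsManifold 𝓘(ℝ, EE n) ∞ M]
  {Ω : SymplecticForm n M} {P : Type*} [TopologicalSpace P] [MulAction Gᵐᵒᵖ P]
  {σ : SegalShaleWeil S Mp} {Λ : MetaplecticStructure Mp Ω P} {𝒥 : CompatibleACS Ω}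

/-- The source `W` is finite-dimensional, so an operator is a fixed linear combination of rank one
operators built from its values on a basis. -/
theorem contMDiffAt_clm_of_apply {E' H' F W : Type*} [NormedAddCommGroup E'] [NormedSpace ℝ E']
    [TopologicalSpace H'] {I' : ModelWithCorners ℝ E' H'} {M' : Type*} [TopologicalSpace M']
    [ChartedSpace H' M'] [NormedAddCommGroup W] [NormedSpace ℝ W] [FiniteDimensional ℝ W]
    [NormedAddCommGroup F] [NormedSpace ℝ F] {r : ℕ∞ω} {m : M'} {A : M' → W →L[ℝ] F}
    (hA : ∀ w, ContMDiffAt I' 𝓘(ℝ, F) r (fun m => A m w) m) :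
    ContMDiffAt I' 𝓘(ℝ, W →L[ℝ] F) r A m := by
  set b := Module.finBasis ℝ W
  have h : A = fun m => ∑ i, (b.coord i).toContinuousLinearMap.smulRightL ℝ W F (A m (b i)) := by
    funext m
    ext w
    conv_lhs => rw [← b.sum_repr w, map_sum]
    simp [sum_apply]
  rw [h]
  refine contMDiffAt_finsetSum fun i _ => ?_
  exact ((ContinuousLinearMap.smulRightL ℝ W F
    (b.coord i).toContinuousLinearMap).contDiff.contMDiff.contMDiffAt).comp m (hA (b i))

theorem contMDiffOn_const_smul {E' H' Y : Type*} [NormedAddCommGroup E'] [NormedSpace ℝ E']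
    [TopologicalSpace H'] {I' : ModelWithCorners ℝ E' H'} {M' : Type*} [TopologicalSpace M']
    [ChartedSpace H' M'] [NormedAddCommGroup Y] [NormedSpace ℂ Y] {r : ℕ∞ω} {s : Set M'}
    {f : M' → Y} (c : ℂ) (hf : ContMDiffOn I' 𝓘(ℝ, Y) r f s) :
    ContMDiffOn I' 𝓘(ℝ, Y) r (fun m => c • f m) s :=
  (((c • ContinuousLinearMap.id ℂ Y).restrictScalars ℝ).contDiff.contMDiff).comp_contMDiffOn hf

theorem isUnit_units_smul {Y : Type*} [NormedAddCommGroup Y] [NormedSpace ℂ Y] (c : ℂˣ)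
    {a : Y →L[ℂ] Y} (ha : IsUnit a) : IsUnit ((c : ℂ) • a) :=
  ha.smul c

/-- The pullback acts on the factor of forms and `a` on the factor `H`, so the two commute. -/
theorem smul_pullback_act {E : Type*} [NormedAddCommGroup E] [InnerProductSpace ℂ E]
    [CompleteSpace E] {N : ℕ} (c : ℂ) (A : V →L[ℝ] V) (f : Forms N V (HDual E)) (a : CH E) :
    c • pullback N (HDual E) A (f.act a) = Forms.act (c • pullback N (HDual E) A f) a := by
  rw [pullback_apply, pullback_apply, Forms.act, Forms.act, Forms.map_smul, Forms.map_map,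
    Forms.map_map]
  rfl

theorem contMDiffOn_smul_pullback {E' H' X : Type*} [NormedAddCommGroup E'] [NormedSpace ℝ E']
    [TopologicalSpace H'] {I' : ModelWithCorners ℝ E' H'} {M' : Type*} [TopologicalSpace M']
    [ChartedSpace H' M'] [NormedAddCommGroup X] [NormedSpace ℂ X] {N : ℕ} {r : ℕ∞ω} {s : Set M'}
    (c : ℂ) {A : M' → V →L[ℝ] V} (hA : ∀ v, ContMDiffOn I' 𝓘(ℝ, V) r (fun m => A m v) s) :
    ContMDiffOn I' 𝓘(ℝ, Forms N V X →L[ℂ] Forms N V X) r (fun m => c • pullback N X (A m)) s :=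
  contMDiffOn_const_smul (Y := Forms N V X →L[ℂ] Forms N V X) c (contMDiffOn_pullback hA)

theorem isUnit_smul_pullback {X : Type*} [NormedAddCommGroup X] [NormedSpace ℂ X] {N : ℕ}
    (c : ℂˣ) (A : V ≃L[ℝ] V) : IsUnit ((c : ℂ) • pullback N X (A : V →L[ℝ] V)) :=
  isUnit_units_smul (Y := Forms N V X) c (isUnit_pullback A)

namespace LocalFrame

/-- A local frame in the coordinates around `m₀`. -/
def coord (F : LocalFrame n V M) (m₀ m : M) : V →L[ℝ] EE n :=
  ((tangentTriv n m₀).continuousLinearMapAt ℝ m).comp (F.toFun m : V →L[ℝ] TT n m)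

/-- A local frame in coordinates, as an isomorphism. -/
def coordEquiv (F : LocalFrame n V M) {m₀ m : M} (h : m ∈ (tangentTriv n m₀).baseSet) :
    V ≃L[ℝ] EE n :=
  (F.toFun m).trans ((tangentTriv n m₀).continuousLinearEquivAt ℝ m h)

theorem coe_coordEquiv (F : LocalFrame n V M) {m₀ m : M} (h : m ∈ (tangentTriv n m₀).baseSet) :
    (F.coordEquiv h : V →L[ℝ] EE n) = F.coord m₀ m := by
  ext v
  simp [coordEquiv, coord, Bundle.Trivialization.coe_linearMapAt_of_mem _ h]

theorem contMDiffAt_coord (F : LocalFrame n V M) {m₀ : M} (hm : m₀ ∈ F.domain) :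
    ContMDiffAt 𝓘(ℝ, EE n) 𝓘(ℝ, V →L[ℝ] EE n) ∞ (F.coord m₀) m₀ := by
  refine contMDiffAt_clm_of_apply fun v => ?_
  have h1 := (F.smooth v).contMDiffAt (F.isOpen_domain.mem_nhds hm)
  have h2 := (Bundle.contMDiffAt_section (E := fun m : M => TT n m) m₀).1 h1
  refine h2.congr_of_eventuallyEq ?_
  filter_upwards [eventually_mem_baseSet (n := n) m₀] with m hb
  simp [coord, Bundle.Trivialization.coe_linearMapAt_of_mem _ hb]

/-- The change of frames `F_m⁻¹ ∘ F'_m`. -/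
def transition (F F' : LocalFrame n V M) (m : M) : V ≃L[ℝ] V :=
  (F'.toFun m).trans (F.toFun m).symm

theorem transition_eq (F F' : LocalFrame n V M) {m₀ m : M}
    (h : m ∈ (tangentTriv n m₀).baseSet) :
    (F.transition F' m : V →L[ℝ] V) =
      (ContinuousLinearMap.inverse (F.coord m₀ m)).comp (F'.coord m₀ m) := by
  rw [← coe_coordEquiv F h, ← coe_coordEquiv F' h, ContinuousLinearMap.inverse_equiv]
  ext v
  exact congrArg (F.toFun m).symm
    (((tangentTriv n m₀).continuousLinearEquivAt ℝ m h).symm_apply_apply (F'.toFun m v)).symm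

/-- Near each point the change of frames is one smooth coordinate matrix times the inverse of
another, and inversion of operators is smooth. -/
theorem contMDiffOn_transition (F F' : LocalFrame n V M) (v : V) :
    ContMDiffOn 𝓘(ℝ, EE n) 𝓘(ℝ, V) ∞ (fun m => (F.transition F' m : V →L[ℝ] V) v)
      (F.domain ∩ F'.domain) := by
  have : CompleteSpace V := FiniteDimensional.complete ℝ V
  intro m₀ hm
  refine ContMDiffAt.contMDiffWithinAt ?_
  have hb : m₀ ∈ (tangentTriv n m₀).baseSet := FiberBundle.mem_baseSet_trivializationAt' m₀
  have hi : ContMDiffAt 𝓘(ℝ, V →L[ℝ] EE n) 𝓘(ℝ, EE n →L[ℝ] V) ∞ ContinuousLinearMap.inverse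
      (F.coord m₀ m₀) := by
    rw [← coe_coordEquiv F hb]
    exact (contDiffAt_map_inverse (F.coordEquiv hb)).contMDiffAt
  have h1 := ContMDiffAt.clm_apply (hi.comp m₀ (F.contMDiffAt_coord hm.1))
    (ContMDiffAt.clm_apply (F'.contMDiffAt_coord hm.2) (contMDiffAt_const (c := v)))
  refine h1.congr_of_eventuallyEq ?_
  filter_upwards [eventually_mem_baseSet (n := n) m₀] with m hb'
  rw [transition_eq F F' hb']
  rfl

end LocalFrame

namespace ReducedBundle

variable (J : KuiperMap σ Λ)

/-- Source chart and bundle map both apply the same fibre unitary of `J`, so it drops out of the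
comparison. Only the change of tangent frames and the factor `μ'/μ` remain, which is why a merely
continuous Kuiper map yields a smooth isomorphism. -/
theorem chart_toFormBundle (F F' : LocalFrame n V M) (μ μ' : ℂˣ) (x : ReducedBundle σ Λ 𝒥) :
    FormBundle.chart F' μ' (toFormBundle J x) =
      ((μ' / μ : ℂˣ) : ℂ) • pullback (2 * n) S.H (F.transition F' (proj x) : V →L[ℝ] V)
        (chart J F μ x) := by
  induction x using Assoc.ind with
  | h q f =>
    change (μ' : ℂ) • Forms.map (F'.toFun (Λ.Λ q.toP).base : V →L[ℝ] TT n (Λ.Λ q.toP).base)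
        (ContinuousLinearMap.id ℂ S.H)
        (Forms.map ((Λ.Λ q.toP).frame.symm : TT n (Λ.Λ q.toP).base →L[ℝ] V)
          (J.fib q.toP : S.H →L[ℂ] S.H) f) =
      _ • pullback (2 * n) S.H (F.transition F' (Λ.Λ q.toP).base : V →L[ℝ] V) ((μ : ℂ) •
        Forms.map (F.compare (Λ.Λ q.toP) : V →L[ℝ] V) (J.fib q.toP : S.H →L[ℂ] S.H) f)
    rw [map_smul, smul_smul, pullback_apply, Forms.map_map, Forms.map_map]
    have h1 : ((μ' / μ : ℂˣ) : ℂ) * μ = μ' := by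
      rw [← Units.val_mul, div_mul_cancel]
    rw [h1]
    congr 2
    ext v
    change (Λ.Λ q.toP).frame.symm (F'.toFun _ v) =
      (Λ.Λ q.toP).frame.symm (F.toFun _ ((F.toFun _).symm (F'.toFun _ v)))
    exact congrArg _ ((F.toFun _).apply_symm_apply _).symm

theorem isUnitaryIso_homeomorphFormBundle : IsUnitaryIso J 𝒥 (homeomorphFormBundle J) where
  base_eq := toFormBundle_base J
  map_add x y h := toFormBundle_add J x y h _
  map_smul := toFormBundle_smul J
  map_act := toFormBundle_act J
  map_prod x y h := toFormBundle_prod J x y h _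
  smooth F F' μ μ' := by
    refine ⟨fun m => ((μ' / μ : ℂˣ) : ℂ) • pullback (2 * n) S.H (F.transition F' m : V →L[ℝ] V),
      ?_, fun m _ => ⟨?_, fun f a => ?_⟩, fun x _ => chart_toFormBundle J F F' μ μ' x⟩
    · exact contMDiffOn_smul_pullback _ (F.contMDiffOn_transition F')
    · exact isUnit_smul_pullback _ (F.transition F' m)
    · exact smul_pullback_act _ _ f a

end ReducedBundle

end TransitionFunctions

end Metaplectic

end

theorem lemma11 {n : ℕ}
    {V : Type*} [NormedAddCommGroup V] [InnerProductSpace ℝ V] [FiniteDimensional ℝ V]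
    [MeasurableSpace V] [BorelSpace V] (S : SymplecticModel n V)
    {G : Type*} [Group G] [TopologicalSpace G] [IsTopologicalGroup G] (Mp : MetaplecticGroup S G)
    (σ : SegalShaleWeil S Mp)
    {M : Type*} [TopologicalSpace M] [T2Space M] [SecondCountableTopology M]
    [ChartedSpace (EE n) M] [IsManifold 𝓘(ℝ, EE n) ∞ M] (Ω : SymplecticForm n M)
    {P : Type*} [TopologicalSpace P] [MulAction Gᵐᵒᵖ P] (Λ : MetaplecticStructure Mp Ω P)
    (𝒥 : CompatibleACS Ω) (J : KuiperMap σ Λ) :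
    ∃ T : ReducedBundle σ Λ 𝒥 ≃ₜ FormBundle n M S.H,
      IsUnitaryIso J 𝒥 T ∧
      ∀ (q : Λ.Reduction 𝒥) (k : Fin (2 * n + 1)) (α : TT n (Λ.pr q.toP) [⋀^Fin k]→L[ℝ] ℝ)
        (u : S.H),
        T (ReducedBundle.tmul σ q α u) =
          FormBundle.tmul α (J.toHomeomorph (Assoc.mk σ.osc q.toP u)).2 := by
  exact ⟨ReducedBundle.homeomorphFormBundle J, ReducedBundle.isUnitaryIso_homeomorphFormBundle J,
    fun q _ α u => ReducedBundle.toFormBundle_tmul J q α u⟩
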